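/- Let $(X_n)_{n\ge 0}$ be the $(2,1)$-reflecting random walk on $\{0,1,2,\dots\}$: a Markov chain with transition probabilities $P_{01}=p(0)=1$ (and $q_1(0)=q_2(0)=0$), $P_{12}=p(1)$, $P_{10}=q_1(1)+q_2(1)$, and, for $i\ge 2$, $P_{i,i+1}=p(i)$, $P_{i,i-1}=q_1(i)$, $P_{i,i-2}=q_2(i)$, where $q_1(i),q_2(i)\ge 0$, $0<p(i)<1$ and $q_1(i)+q_2(i)+p(i)=1$ for $i\ge1$. Write $P^i,E^i$ for probability and expectation when $X_0=i$, and $$T_i=\inf\{n>0: X_n=i\},\qquad \tau_0=0,\quad \tau_i=\inf\{n>0:X_n<i\}\ (i\ge 1).$$ Let $P^i[(i,n),b]$ and $P^i[(i,+\infty),b]$ be the $P^i$-probabilities that the walk leaves $\{i,\dots,n\}$, respectively $\{i,i+1,\dots\}$, and does so at the point $b$. Assume $E^1\tau_1<\infty$. Then the walk is positive recurrent, the expectations $E^{i}\tau_{i}$ ($i\ge 1$) and $E^{i}T_{i+1}$ ($i\ge 0$) are finite, and the walk has exactly one stationary distribution $\pi$, given for all $i\ge 0$ by $$\pi(i)=\frac1{E^iT_i}=\frac{1}{p(i)E^{i+1}\tau_{i+1}+\bigl(q_1(i)+q_2(i)+p(i)P^{i+1}[(i+1,+\infty),i-1]\bigr)E^{i-1}T_i+q_2(i)E^{i-2}T_{i-1}+1},$$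 where $E^{j}T_{j+1}$ is read as $0$ for $j<0$ (and $P^{1}[(1,+\infty),-1]=0$). Moreover: (a) For $2\le i\le n$, put $\tilde M_k=\begin{pmatrix}\frac{q_1(k)+q_2(k)}{p(k)}&\frac{q_2(k)}{p(k)}\\1&0\end{pmatrix}$ and $S_{i,n}=\sum_{k=i}^{n}\tilde M_k\tilde M_{k-1}\cdots\tilde M_i$. With $e_1=(1,0)$, $e_2=(0,1)$ (as column vectors where needed), $$P^i[(i,n),i-1]=\frac{\langle e_1,S_{i,n}(e_1-e_2)\rangle}{1+\langle e_1,S_{i,n}e_1\rangle},\qquad P^i[(i,n),i-2]=\frac{\langle e_1,S_{i,n}e_2\rangle}{1+\langle e_1,S_{i,n}e_1\rangle},$$ and, as $n\to\infty$, these expressions converge to $P^i[(i,+\infty),i-1]$ and $P^i[(i,+\infty),i-2]$ respectively. (b) For $i\ge 1$ let $\gamma(i)=p(i)P^{i+1}[(i+1,+\infty),i-1]$, $$\alpha(i)=p(i)P^{i+1}[(i+1,+\infty),i]\frac{q_1(i+1)}{q_1(i+1)+\gamma(i+1)},\qquad \beta(i)=p(i)P^{i+1}[(i+1,+\infty),i]\frac{\gamma(i+1)}{q_1(i+1)+\gamma(i+1)}$$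 (both are $0$ if $q_1(i+1)+\gamma(i+1)=0$), and $$N_k=\begin{pmatrix}\frac{\alpha(k)}{1-\alpha(k)-\beta(k)}&\frac{\beta(k)}{1-\alpha(k)-\beta(k)}&0\\ \frac{\alpha(k)}{1-\alpha(k)-\beta(k)}&\frac{\beta(k)}{1-\alpha(k)-\beta(k)}&1\\ \frac{\alpha(k)}{1-\alpha(k)-\beta(k)}&\frac{\beta(k)}{1-\alpha(k)-\beta(k)}&0\end{pmatrix}.$$ Then for $i\ge1$ the matrix series below converges and $$E^i\tau_i=1+\Bigl\langle(2,2,1),\ \tfrac{1}{1-\alpha(i)-\beta(i)}\bigl(q_1(i),\gamma(i),q_2(i)\bigr)\sum_{k=i}^{\infty}N_iN_{i+1}\cdots N_k\Bigr\rangle .$$ (c) Let $M_1=\begin{pmatrix}\frac{q_1(1)+q_2(1)}{p(1)}&0\\ \frac1{p(1)}&0\end{pmatrix}$ and $M_i=\begin{pmatrix}\frac{q_1(i)}{p(i)}&\frac{q_2(i)}{p(i)}\\1+\frac{q_1(i)}{p(i)}&\frac{q_2(i)}{p(i)}\end{pmatrix}$ for $i>1$. Then for $i\ge 0$ $$E^iT_{i+1}=1+\sum_{k=1}^{i}e_1M_iM_{i-1}\cdots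 M_{i-k+1}(2,1)'.$$ -/

import Mathlib

open MeasureTheory ProbabilityTheory Filter Topology
open scoped ENNReal Matrix

noncomputable section

/-- The data of a `(2,1)`-reflecting random walk on `ℕ = {0, 1, 2, …}`: from `i` the walk goes up
by one with probability `p i` and down by `k` with probability `q₁ i`, `q₂ i` (`k = 1, 2`), a jump
below `0` being stopped at `0`. The fields force `q₁ 0 = q₂ 0 = 0`. -/
structure ReflectingWalk where
  p : ℕ → ℝ
  q₁ : ℕ → ℝ
  q₂ : ℕ → ℝ
  p_zero : p 0 = 1
  p_pos : ∀ i, 1 ≤ i → 0 < p i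
  p_lt_one : ∀ i, 1 ≤ i → p i < 1
  q₁_nonneg : ∀ i, 0 ≤ q₁ i
  q₂_nonneg : ∀ i, 0 ≤ q₂ i
  sum_eq_one : ∀ i, q₁ i + q₂ i + p i = 1

namespace ReflectingWalk

variable (W : ReflectingWalk)

lemma p_nonneg (i : ℕ) : 0 ≤ W.p i := by
  rcases Nat.eq_zero_or_pos i with h | h
  · rw [h, W.p_zero]; exact zero_le_one
  · exact (W.p_pos i h).le

/-- The transition kernel. The subtraction is the truncated one of `ℕ`, so that the jump by two
from state `1` ends in `0`: `P(1, 0) = q₁ 1 + q₂ 1`, and `P(0, 1) = p 0 = 1`. -/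
def kernel : Kernel ℕ ℕ :=
  Kernel.ofFunOfCountable fun i =>
    ENNReal.ofReal (W.p i) • Measure.dirac (i + 1)
      + ENNReal.ofReal (W.q₁ i) • Measure.dirac (i - 1)
      + ENNReal.ofReal (W.q₂ i) • Measure.dirac (i - 2)

instance : IsMarkovKernel W.kernel where
  isProbabilityMeasure i := by
    refine ⟨?_⟩
    change (ENNReal.ofReal (W.p i) • Measure.dirac (i + 1)
      + ENNReal.ofReal (W.q₁ i) • Measure.dirac (i - 1)
      + ENNReal.ofReal (W.q₂ i) • Measure.dirac (i - 2) : Measure ℕ) Set.univ = 1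
    simp only [Measure.add_apply, Measure.smul_apply, measure_univ, smul_eq_mul, mul_one]
    rw [← ENNReal.ofReal_add (W.p_nonneg i) (W.q₁_nonneg i),
      ← ENNReal.ofReal_add (add_nonneg (W.p_nonneg i) (W.q₁_nonneg i)) (W.q₂_nonneg i),
      ← ENNReal.ofReal_one]
    congr 1
    linarith [W.sum_eq_one i]

/-- `P^i`: the law on path space of the Markov chain with transition kernel `W.kernel` started
at `i` (Ionescu-Tulcea). The walk is the coordinate process `X_n ω = ω n`. -/
def law (i : ℕ) : Measure (ℕ → ℕ) :=
  Kernel.trajMeasure (X := fun _ => ℕ) (Measure.dirac i)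
    fun n => W.kernel.comap (fun x : (k : Finset.Iic n) → ℕ => x ⟨n, Finset.mem_Iic.2 le_rfl⟩)
      (measurable_pi_apply _)

/-- `T_j = inf {n > 0 : X_n = j}`. -/
def T (j : ℕ) : (ℕ → ℕ) → ℕ∞ :=
  hittingAfter (fun n ω => ω n) {j} 1

/-- `τ_0 = 0` and `τ_j = inf {n > 0 : X_n < j}` for `j ≥ 1`. -/
def tau (j : ℕ) : (ℕ → ℕ) → ℕ∞ :=
  if j = 0 then fun _ => 0 else hittingAfter (fun n ω => ω n) (Set.Iio j) 1

/-- `E^i T_j`. -/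
def meanT (i j : ℕ) : ℝ≥0∞ := ∫⁻ ω, (T j ω : ℝ≥0∞) ∂(W.law i)

/-- `E^i τ_j`. -/
def meanTau (i j : ℕ) : ℝ≥0∞ := ∫⁻ ω, (tau j ω : ℝ≥0∞) ∂(W.law i)

/-- `E^j T_{j+1}` for `j ≥ 0`; by convention `0` for a negative `j`, which is not a state. -/
def meanUp (j : ℤ) : ℝ≥0∞ := if 0 ≤ j then W.meanT j.toNat (j.toNat + 1) else 0

/-- The probability, for the walk started at `i`, that it leaves `S` and that the point at which
it is when it leaves `S` is `b`. The point `b` is an integer; the probability is `0` for `b < 0`. -/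
def exitProb (i : ℕ) (S : Set ℕ) (b : ℤ) : ℝ :=
  (W.law i).real {ω | ∃ m : ℕ, (∀ k < m, ω k ∈ S) ∧ ω m ∉ S ∧ (ω m : ℤ) = b}

/-- Every state is positive recurrent: `E^i T_i < ∞` for all `i`. -/
def PositiveRecurrent : Prop := ∀ i, W.meanT i i < ∞

/-- A stationary distribution: a probability measure `π` on the states with `π P = π`. -/
def IsStationaryDistribution (π : Measure ℕ) : Prop :=
  IsProbabilityMeasure π ∧ Kernel.Invariant W.kernel π

/-- `M_i`, the mean matrices of the lower branching structure (used for `i ≥ 1`). -/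
def M (i : ℕ) : Matrix (Fin 2) (Fin 2) ℝ :=
  if i = 1 then
    !![(W.q₁ 1 + W.q₂ 1) / W.p 1, 0;
       1 / W.p 1, 0]
  else
    !![W.q₁ i / W.p i, W.q₂ i / W.p i;
       1 + W.q₁ i / W.p i, W.q₂ i / W.p i]

/-- The matrices `M̃_i` of the exit probabilities. -/
def Mtilde (i : ℕ) : Matrix (Fin 2) (Fin 2) ℝ :=
  !![(W.q₁ i + W.q₂ i) / W.p i, W.q₂ i / W.p i;
     1, 0]

/-- The descending product `A_k A_{k-1} ⋯ A_i`. -/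
def descProd {m : ℕ} (A : ℕ → Matrix (Fin m) (Fin m) ℝ) (k i : ℕ) : Matrix (Fin m) (Fin m) ℝ :=
  ((List.range' i (k + 1 - i)).reverse.map A).prod

/-- The ascending product `A_i A_{i+1} ⋯ A_k`. -/
def ascProd {m : ℕ} (A : ℕ → Matrix (Fin m) (Fin m) ℝ) (i k : ℕ) : Matrix (Fin m) (Fin m) ℝ :=
  ((List.range' i (k + 1 - i)).map A).prod

/-- `M̃_i + M̃_{i+1} M̃_i + ⋯ + M̃_n ⋯ M̃_i`. -/
def exitSum (i n : ℕ) : Matrix (Fin 2) (Fin 2) ℝ :=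
  ∑ k ∈ Finset.Icc i n, descProd W.Mtilde k i

/-- `⟨e₁, S v⟩ / (1 + ⟨e₁, S e₁⟩)` with `S = exitSum i n`, the explicit expression of an exit
probability from `{i, …, n}`. -/
def exitFormula (i n : ℕ) (v : Fin 2 → ℝ) : ℝ :=
  (![1, 0] ⬝ᵥ W.exitSum i n *ᵥ v) / (1 + ![1, 0] ⬝ᵥ W.exitSum i n *ᵥ ![1, 0])

/-- `γ(i) = p(i) P^{i+1}[(i+1, ∞), i-1]`. -/
def gamma (i : ℕ) : ℝ := W.p i * W.exitProb (i + 1) (Set.Ici (i + 1)) ((i : ℤ) - 1)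

/-- `α(i)`. If the denominator vanishes then so does the exit probability. -/
def alpha (i : ℕ) : ℝ :=
  W.p i * W.exitProb (i + 1) (Set.Ici (i + 1)) i
    * (W.q₁ (i + 1) / (W.q₁ (i + 1) + W.gamma (i + 1)))

/-- `β(i)`. If the denominator vanishes then so does the exit probability. -/
def beta (i : ℕ) : ℝ :=
  W.p i * W.exitProb (i + 1) (Set.Ici (i + 1)) i
    * (W.gamma (i + 1) / (W.q₁ (i + 1) + W.gamma (i + 1)))

/-- `N_k`, the mean matrices of the upper branching structure (used for `k ≥ 1`). -/
def N (k : ℕ) : Matrix (Fin 3) (Fin 3) ℝ :=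
  let a := W.alpha k / (1 - W.alpha k - W.beta k)
  let b := W.beta k / (1 - W.alpha k - W.beta k)
  !![a, b, 0;
     a, b, 1;
     a, b, 0]

/-- The mean `(1 - α(i) - β(i))⁻¹ (q₁(i), γ(i), q₂(i))` of the immigration at level `i`. -/
def immigration (i : ℕ) : Fin 3 → ℝ :=
  (1 / (1 - W.alpha i - W.beta i)) • ![W.q₁ i, W.gamma i, W.q₂ i]

/-- `p(i) E^{i+1}τ_{i+1} + (q₁(i) + q₂(i) + p(i) P^{i+1}[(i+1,∞), i-1]) E^{i-1}T_i
+ q₂(i) E^{i-2}T_{i-1} + 1`. -/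
def returnFormula (i : ℕ) : ℝ :=
  W.p i * (W.meanTau (i + 1) (i + 1)).toReal
    + (W.q₁ i + W.q₂ i + W.p i * W.exitProb (i + 1) (Set.Ici (i + 1)) ((i : ℤ) - 1))
      * (W.meanUp ((i : ℤ) - 1)).toReal
    + W.q₂ i * (W.meanUp ((i : ℤ) - 2)).toReal
    + 1

end ReflectingWalk

end

noncomputable section

/-! The walk climbs one level at a time and descends by at most two. On its way up it therefore
visits every intermediate level, and a stay in `{k, k+1, …}` begun at `k`, if it ends, ends at `k -
1` or `k - 2`. All quantities are expected rewards `value S φ r` collected up to the exit from a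
set. Such a reward is the least nonnegative solution of its one-step equation, and this minimality
yields the strong Markov property `value_eq_value_of_subset`. The lemmas `law_exit` and
`lintegral_hittingAfter` connect it with the path measure.

By `exitTime_Ici_eq`, finiteness of `E^1 τ_1` propagates to every `E^k τ_k`, since `p(k) > 0`;
climbing times are always finite. Splitting a return to `i` by its first step, and an upward step by
the point where the walk next falls below `i + 1`, gives `toReal_meanT_self`.

For (a), `M̃_k` carries the increments of a harmonic function one level up, and telescoping gives a
linear equation for the exit probability. For (c), first-step recursions are solved by matrix
products.

For (b), the numbers `E_k = E^k τ_k` satisfy `(1 - α(k) - β(k)) E_k = 1 + p(k) E_{k+1}`, which alone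
does not determine them. The partial sums of the series obey the same recursion with the number of
terms lowered by one, so they stay below `E_k`. Their limit is a nonnegative solution, so it is at
least `E_k` by the minimality statement `exitTime_Ici_le`.

Kac's formula `stationary_mul_meanT` gives the values and the uniqueness of the stationary
distribution; the occupation measure of an excursion from `0` gives existence. -/

/-- Two finite measures on `ℕ → ℕ` that agree on all cylinders over initial segments are equal. -/
lemma MeasureTheory.Measure.ext_of_initial_cylinder {μ ν : Measure (ℕ → ℕ)} [IsFiniteMeasure μ]
    (h : ∀ (n : ℕ) (a : ℕ → ℕ), μ {ω | ∀ k ≤ n, ω k = a k} = ν {ω | ∀ k ≤ n, ω k = a k}) :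
    μ = ν := by
  have key : ∀ n, μ.map (Preorder.frestrictLe (π := fun _ => ℕ) n)
      = ν.map (Preorder.frestrictLe (π := fun _ => ℕ) n) := by
    intro n
    refine Measure.ext_of_singleton fun a => ?_
    have hm := Preorder.measurable_frestrictLe (X := fun _ : ℕ => ℕ) n
    rw [Measure.map_apply hm (measurableSet_singleton a),
      Measure.map_apply hm (measurableSet_singleton a)]
    have hset : Preorder.frestrictLe (π := fun _ : ℕ => ℕ) n ⁻¹' {a}
        = {ω | ∀ k ≤ n, ω k = if hk : k ≤ n then a ⟨k, Finset.mem_Iic.2 hk⟩ else 0} := by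
      ext ω
      simp only [Set.mem_preimage, Set.mem_singleton_iff, Set.mem_ofPred_eq, funext_iff]
      constructor
      · intro H k hk
        rw [dif_pos hk]
        exact H ⟨k, Finset.mem_Iic.2 hk⟩
      · rintro H ⟨k, hk⟩
        have := H k (Finset.mem_Iic.1 hk)
        rw [dif_pos (Finset.mem_Iic.1 hk)] at this
        exact this
    rw [hset]
    exact h n _
  have hproj : IsProjectiveLimit ν fun I : Finset ℕ => μ.map (I.restrict (π := fun _ => ℕ)) := by
    intro I
    have hI := I.subset_Iic_sup_id
    have e := key (I.sup id)
    have := congrArg (fun m => Measure.map (Finset.restrict₂ (π := fun _ : ℕ => ℕ) hI) m) e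
    simp only [Preorder.frestrictLe] at this
    rw [Measure.map_map (by fun_prop) (by fun_prop), Measure.map_map (by fun_prop) (by fun_prop),
      Finset.restrict₂_comp_restrict] at this
    exact this.symm
  have hproj' : IsProjectiveLimit μ fun I : Finset ℕ => μ.map (I.restrict (π := fun _ => ℕ)) :=
    fun _ => rfl
  exact hproj'.unique hproj

/-! ### The transition operator and the Markov property at time one. -/

namespace ReflectingWalk

variable (W : ReflectingWalk)

/-- The path that starts at `x` and then follows `ω`. -/
def consPath (x : ℕ) (ω : ℕ → ℕ) : ℕ → ℕ
  | 0 => x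
  | n + 1 => ω n

@[simp] lemma consPath_zero (x : ℕ) (ω : ℕ → ℕ) : consPath x ω 0 = x := rfl

@[simp] lemma consPath_succ (x : ℕ) (ω : ℕ → ℕ) (n : ℕ) : consPath x ω (n + 1) = ω n := rfl

lemma measurable_consPath (x : ℕ) : Measurable (consPath x) := by
  refine measurable_pi_lambda _ fun n => ?_
  cases n with
  | zero => exact measurable_const
  | succ n => exact measurable_pi_apply n

/-- The transition operator `f ↦ P f` on nonnegative functions. -/
def op (f : ℕ → ℝ≥0∞) (x : ℕ) : ℝ≥0∞ :=
  ENNReal.ofReal (W.p x) * f (x + 1) + ENNReal.ofReal (W.q₁ x) * f (x - 1)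
    + ENNReal.ofReal (W.q₂ x) * f (x - 2)

lemma lintegral_kernel (f : ℕ → ℝ≥0∞) (x : ℕ) : ∫⁻ y, f y ∂(W.kernel x) = W.op f x := by
  change ∫⁻ y, f y ∂(ENNReal.ofReal (W.p x) • Measure.dirac (x + 1)
      + ENNReal.ofReal (W.q₁ x) • Measure.dirac (x - 1)
      + ENNReal.ofReal (W.q₂ x) • Measure.dirac (x - 2) : Measure ℕ) = _
  simp [lintegral_add_measure, lintegral_smul_measure, op]

lemma kernel_apply_singleton (x y : ℕ) :
    W.kernel x {y} = W.op (fun z => if z = y then 1 else 0) x := by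
  rw [← lintegral_kernel, ← lintegral_indicator_one (measurableSet_singleton y)]
  refine lintegral_congr fun z => ?_
  simp [Set.indicator]

instance (i : ℕ) : IsProbabilityMeasure (W.law i) := by
  unfold law; infer_instance

lemma law_start (i : ℕ) : ∀ᵐ ω ∂W.law i, ω 0 = i := by
  set κ : (n : ℕ) → Kernel ((k : Finset.Iic n) → ℕ) ℕ := fun n =>
    W.kernel.comap (fun x : (k : Finset.Iic n) → ℕ => x ⟨n, Finset.mem_Iic.2 le_rfl⟩)
      (measurable_pi_apply _) with hκ
  have hm : MeasurableSet {ω : ℕ → ℕ | ω 0 = i} :=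
    measurable_pi_apply (X := fun _ : ℕ => ℕ) 0 (measurableSet_singleton i)
  have h0 : ∀ x : (k : Finset.Iic 0) → ℕ,
      Kernel.traj (X := fun _ => ℕ) κ 0 x {ω | ω 0 = i}ᶜ
        = if x ⟨0, Finset.mem_Iic.2 le_rfl⟩ = i then 0 else 1 := by
    intro x
    have e := Kernel.traj_map_frestrictLe_apply (X := fun _ => ℕ) (κ := κ) 0 0 x
    rw [Kernel.partialTraj_self, Kernel.id_apply] at e
    have hs : MeasurableSet {z : (k : Finset.Iic 0) → ℕ | z ⟨0, Finset.mem_Iic.2 le_rfl⟩ = i}ᶜ :=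
      (measurable_pi_apply (X := fun _ : Finset.Iic 0 => ℕ) _ (measurableSet_singleton i)).compl
    have e2 := congrArg
      (fun m => m {z : (k : Finset.Iic 0) → ℕ | z ⟨0, Finset.mem_Iic.2 le_rfl⟩ = i}ᶜ) e
    simp only [Measure.map_apply (Preorder.measurable_frestrictLe (X := fun _ : ℕ => ℕ) 0) hs,
      Measure.dirac_apply' _ hs] at e2
    refine Eq.trans e2 ?_
    by_cases hx : x ⟨0, Finset.mem_Iic.2 le_rfl⟩ = i <;> simp [hx, Set.indicator]
  rw [ae_iff]
  change W.law i {ω | ω 0 = i}ᶜ = 0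
  unfold law Kernel.trajMeasure
  rw [Measure.bind_apply hm.compl (Kernel.aemeasurable _)]
  simp_rw [← hκ, h0]
  rw [lintegral_map (measurable_of_countable _) (MeasurableEquiv.measurable _), lintegral_dirac]
  simp [MeasurableEquiv.piUnique, Equiv.piUnique]

lemma law_cylinder_succ (i n : ℕ) (a : ℕ → ℕ) :
    W.law i {ω | ∀ k ≤ n + 1, ω k = a k}
      = W.law i {ω | ∀ k ≤ n, ω k = a k} * W.kernel (a n) {a (n + 1)} := by
  set κ : (n : ℕ) → Kernel ((k : Finset.Iic n) → ℕ) ℕ := fun n =>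
    W.kernel.comap (fun x : (k : Finset.Iic n) → ℕ => x ⟨n, Finset.mem_Iic.2 le_rfl⟩)
      (measurable_pi_apply _) with hκ
  have e := Kernel.map_frestrictLe_trajMeasure_compProd_eq_map_trajMeasure
    (X := fun _ => ℕ) (κ := κ) (μ₀ := Measure.dirac i) (a := n)
  have hm := Preorder.measurable_frestrictLe (X := fun _ : ℕ => ℕ) n
  set b : (k : Finset.Iic n) → ℕ := fun k => a k
  have hb : ∀ ω : ℕ → ℕ, Preorder.frestrictLe (π := fun _ : ℕ => ℕ) n ω = b
      ↔ ∀ k ≤ n, ω k = a k := by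
    intro ω
    rw [funext_iff]
    exact ⟨fun H k hk => H ⟨k, Finset.mem_Iic.2 hk⟩, fun H k => H k (Finset.mem_Iic.1 k.2)⟩
  have e2 := congrArg (fun m => m ({b} ×ˢ {a (n + 1)})) e
  rw [Measure.compProd_apply_prod (measurableSet_singleton _) (measurableSet_singleton _),
    Measure.map_apply (hm.prodMk (measurable_pi_apply _))
      ((measurableSet_singleton _).prod (measurableSet_singleton _)),
    Measure.restrict_singleton, lintegral_smul_measure, lintegral_dirac,
    Measure.map_apply hm (measurableSet_singleton _)] at e2
  change W.law i _ * _ = W.law i _ at e2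
  have s1 : Preorder.frestrictLe (π := fun _ : ℕ => ℕ) n ⁻¹' {b} = {ω | ∀ k ≤ n, ω k = a k} := by
    ext ω; exact hb ω
  have s2 : (fun x : ℕ → ℕ => (Preorder.frestrictLe (π := fun _ : ℕ => ℕ) n x, x (n + 1))) ⁻¹'
      ({b} ×ˢ {a (n + 1)}) = {ω | ∀ k ≤ n + 1, ω k = a k} := by
    ext ω
    simp only [Set.mem_preimage, Set.mem_prod, Set.mem_singleton_iff, Set.mem_ofPred_eq, hb]
    constructor
    · rintro ⟨h1, h2⟩ k hk
      rcases Nat.lt_or_ge n k with h | h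
      · obtain rfl : k = n + 1 := by omega
        exact h2
      · exact h1 k h
    · exact fun H => ⟨fun k hk => H k (by omega), H _ le_rfl⟩
  rw [s1, s2] at e2
  rw [← e2]
  rfl

lemma law_cylinder_zero (i : ℕ) (a : ℕ → ℕ) :
    W.law i {ω | ∀ k ≤ 0, ω k = a k} = if a 0 = i then 1 else 0 := by
  have hset : {ω : ℕ → ℕ | ∀ k ≤ 0, ω k = a k} = {ω | ω 0 = a 0} := by
    ext ω; simp
  rw [hset]
  have h := W.law_start i
  split_ifs with ha
  · rw [ha]
    exact (ae_iff_prob_eq_one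
      (measurableSet_setOfPred.1 (measurable_pi_apply (X := fun _ : ℕ => ℕ) 0
        (measurableSet_singleton i)))).1 h
  · refine measure_mono_null (fun ω hω => ?_) (ae_iff.1 h)
    exact fun h' => ha (by rw [← h', ← hω.out])

/-- The law of the path started at `x`, decomposed according to the first step. -/
lemma law_eq_bind (x : ℕ) :
    W.law x = (W.kernel x).bind fun y => (W.law y).map (consPath x) := by
  have hmeas : Measurable fun y => (W.law y).map (consPath x) := measurable_of_countable _
  have hcyl : ∀ (n : ℕ) (a : ℕ → ℕ), MeasurableSet {ω : ℕ → ℕ | ∀ k ≤ n, ω k = a k} := by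
    intro n a
    have : {ω : ℕ → ℕ | ∀ k ≤ n, ω k = a k} = ⋂ k, ⋂ (_ : k ≤ n), (fun ω => ω k) ⁻¹' {a k} := by
      ext ω; simp
    rw [this]
    exact MeasurableSet.iInter fun k => MeasurableSet.iInter fun _ =>
      measurable_pi_apply (X := fun _ : ℕ => ℕ) k (measurableSet_singleton _)
  have hpre : ∀ (n : ℕ) (a : ℕ → ℕ) (y : ℕ),
      (W.law y).map (consPath x) {ω | ∀ k ≤ n + 1, ω k = a k}
        = (if a 0 = x then 1 else 0) * W.law y {ω | ∀ k ≤ n, ω k = a (k + 1)} := by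
    intro n a y
    rw [Measure.map_apply (measurable_consPath x) (hcyl _ _)]
    split_ifs with ha
    · rw [one_mul]
      congr 1
      ext ω
      constructor
      · exact fun H k hk => H (k + 1) (by omega)
      · rintro H (_ | k) hk
        · exact ha.symm
        · exact H k (by omega)
    · rw [zero_mul]
      convert measure_empty (μ := W.law y)
      refine Set.eq_empty_of_forall_notMem fun ω H => ha ?_
      exact (H 0 (by omega)).symm
  refine Measure.ext_of_initial_cylinder fun n a => ?_
  -- The induction appends transitions at the end of the path by `law_cylinder_succ`, while the
  -- first step stays integrated out.
  have hsucc : ∀ n, W.law x {ω | ∀ k ≤ n + 1, ω k = a k}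
      = ∫⁻ y, (if a 0 = x then 1 else 0) * W.law y {ω | ∀ k ≤ n, ω k = a (k + 1)}
        ∂(W.kernel x) := by
    intro n
    induction n with
    | zero =>
      rw [law_cylinder_succ, law_cylinder_zero]
      have : ∀ y, W.law y {ω | ∀ k ≤ 0, ω k = a (k + 1)} = if y = a 1 then 1 else 0 := by
        intro y
        rw [W.law_cylinder_zero y fun k => a (k + 1)]
        simp [eq_comm]
      simp_rw [this]
      rw [lintegral_const_mul _ (measurable_of_countable _), lintegral_kernel,
        ← kernel_apply_singleton]
      by_cases ha : a 0 = x
      · simp [ha]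
      · simp [ha]
    | succ n ih =>
      rw [law_cylinder_succ, ih, ← lintegral_mul_const _ (measurable_of_countable _)]
      refine lintegral_congr fun y => ?_
      rw [W.law_cylinder_succ y n fun k => a (k + 1), mul_assoc]
  rw [Measure.bind_apply (hcyl n a) hmeas.aemeasurable]
  cases n with
  | zero =>
    have : ∀ y, (W.law y).map (consPath x) {ω | ∀ k ≤ 0, ω k = a k} = if a 0 = x then 1 else 0 := by
      intro y
      rw [Measure.map_apply (measurable_consPath x) (hcyl _ _)]
      by_cases ha : a 0 = x
      · simp [ha]
      · simp [ha, eq_comm]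
    simp_rw [this]
    rw [law_cylinder_zero]
    simp
  | succ n =>
    rw [hsucc]
    exact (lintegral_congr fun y => hpre n a y).symm

/-- The Markov property at time one. -/
lemma lintegral_law {F : (ℕ → ℕ) → ℝ≥0∞} (hF : Measurable F) (x : ℕ) :
    ∫⁻ ω, F ω ∂W.law x = W.op (fun y => ∫⁻ ω, F (consPath x ω) ∂W.law y) x := by
  rw [← lintegral_kernel, law_eq_bind,
    Measure.lintegral_bind (measurable_of_countable _).aemeasurable hF.aemeasurable]
  exact lintegral_congr fun y => lintegral_map hF (measurable_consPath x)

lemma law_apply {A : Set (ℕ → ℕ)} (hA : MeasurableSet A) (x : ℕ) :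
    W.law x A = W.op (fun y => W.law y (consPath x ⁻¹' A)) x := by
  rw [← lintegral_indicator_one hA, lintegral_law _ (measurable_one.indicator hA)]
  congr 1
  ext y
  rw [← lintegral_indicator_one (measurable_consPath x hA)]
  rfl

lemma ofReal_sum_eq_one (x : ℕ) :
    ENNReal.ofReal (W.p x) + ENNReal.ofReal (W.q₁ x) + ENNReal.ofReal (W.q₂ x) = 1 := by
  rw [← ENNReal.ofReal_add (W.p_nonneg x) (W.q₁_nonneg x),
    ← ENNReal.ofReal_add (add_nonneg (W.p_nonneg x) (W.q₁_nonneg x)) (W.q₂_nonneg x),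
    ← ENNReal.ofReal_one]
  congr 1
  linarith [W.sum_eq_one x]

lemma op_mono {f g : ℕ → ℝ≥0∞} (h : ∀ x, f x ≤ g x) (x : ℕ) : W.op f x ≤ W.op g x := by
  unfold op
  gcongr <;> apply h

lemma op_add (f g : ℕ → ℝ≥0∞) (x : ℕ) : W.op (fun y => f y + g y) x = W.op f x + W.op g x := by
  unfold op; ring

lemma op_const_mul (c : ℝ≥0∞) (f : ℕ → ℝ≥0∞) (x : ℕ) :
    W.op (fun y => c * f y) x = c * W.op f x := by
  unfold op; ring

lemma op_const (c : ℝ≥0∞) (x : ℕ) : W.op (fun _ => c) x = c := by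
  unfold op
  rw [← add_mul, ← add_mul, ofReal_sum_eq_one, one_mul]

lemma op_iSup {f : ℕ → ℕ → ℝ≥0∞} (hf : ∀ x, Monotone fun n => f n x) (x : ℕ) :
    W.op (fun y => ⨆ n, f n y) x = ⨆ n, W.op (f n) x := by
  rw [← lintegral_kernel, lintegral_iSup (fun n => measurable_of_countable _)
    (fun m n hmn y => hf y hmn)]
  simp_rw [lintegral_kernel]

lemma op_tsum (f : ℕ → ℕ → ℝ≥0∞) (x : ℕ) :
    W.op (fun y => ∑' n, f n y) x = ∑' n, W.op (f n) x := by
  rw [← lintegral_kernel, lintegral_tsum fun n => (measurable_of_countable _).aemeasurable]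
  simp_rw [lintegral_kernel]

/-! ### Expected rewards up to the exit from a set. -/

open Classical in
/-- The expected payoff of the walk observed for fewer than `n` steps: the walk collects the reward
`r` as long as it stays in `S`, and the reward `φ` at the point where it leaves `S`. -/
def stopValue (S : Set ℕ) (φ r : ℕ → ℝ≥0∞) : ℕ → ℕ → ℝ≥0∞
  | 0, _ => 0
  | n + 1, x => if x ∈ S then r x + W.op (stopValue S φ r n) x else φ x

/-- The expected payoff for the walk that collects the reward `r` at every visit to `S` before
it leaves `S`, and the reward `φ` at the point where it leaves `S`. -/
def value (S : Set ℕ) (φ r : ℕ → ℝ≥0∞) (x : ℕ) : ℝ≥0∞ := ⨆ n, W.stopValue S φ r n x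

variable {S S' : Set ℕ} {φ φ' r r' : ℕ → ℝ≥0∞}

lemma stopValue_le_succ (n x : ℕ) : W.stopValue S φ r n x ≤ W.stopValue S φ r (n + 1) x := by
  induction n generalizing x with
  | zero => exact zero_le
  | succ n ih =>
    rw [stopValue, stopValue]
    split_ifs
    · gcongr
      exact W.op_mono ih x
    · rfl

lemma stopValue_mono (x : ℕ) : Monotone fun n => W.stopValue S φ r n x :=
  monotone_nat_of_le_succ fun n => W.stopValue_le_succ n x

lemma value_of_notMem {x : ℕ} (hx : x ∉ S) : W.value S φ r x = φ x := by
  refine le_antisymm (iSup_le fun n => ?_) (le_iSup_of_le 1 ?_)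
  · cases n with
    | zero => exact zero_le
    | succ n => rw [stopValue, if_neg hx]
  · rw [stopValue, if_neg hx]

lemma value_of_mem {x : ℕ} (hx : x ∈ S) : W.value S φ r x = r x + W.op (W.value S φ r) x := by
  change _ = r x + W.op (fun y => ⨆ n, W.stopValue S φ r n y) x
  rw [op_iSup _ (fun y => W.stopValue_mono y), ENNReal.add_iSup]
  refine le_antisymm (iSup_le fun n => ?_) (iSup_le fun n => le_iSup_of_le (n + 1) ?_)
  · refine (W.stopValue_le_succ n x).trans (le_iSup_of_le n ?_)
    rw [stopValue, if_pos hx]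
  · rw [stopValue, if_pos hx]

/-- `value` is the least solution of its one-step equation. -/
lemma value_le {f : ℕ → ℝ≥0∞} (h1 : ∀ x ∈ S, r x + W.op f x ≤ f x) (h2 : ∀ x ∉ S, φ x ≤ f x)
    (x : ℕ) : W.value S φ r x ≤ f x := by
  refine iSup_le fun n => ?_
  induction n generalizing x with
  | zero => exact zero_le
  | succ n ih =>
    rw [stopValue]
    split_ifs with hx
    · refine le_trans ?_ (h1 x hx)
      gcongr
      exact W.op_mono ih x
    · exact h2 x hx

/-- The strong Markov property at the time when the walk leaves a smaller set. -/
lemma value_eq_value_of_subset (h : S' ⊆ S) (x : ℕ) :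
    W.value S φ r x = W.value S' (W.value S φ r) r x := by
  have h1 : ∀ y, W.value S' (W.value S φ r) r y ≤ W.value S φ r y :=
    W.value_le (fun y hy => (W.value_of_mem (h hy)).ge) fun y _ => le_rfl
  refine le_antisymm (W.value_le (fun y hy => ?_) (fun y hy => ?_) x) (h1 x)
  · by_cases hy' : y ∈ S'
    · exact (W.value_of_mem hy').ge
    -- On `S \ S'` the right-hand side equals `value S φ r`, so expanding one step and applying `h1`
    -- makes it a supersolution there too.
    · rw [W.value_of_notMem hy', W.value_of_mem hy]
      gcongr
      exact W.op_mono h1 y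
  · rw [W.value_of_notMem (fun h' => hy (h h')), W.value_of_notMem hy]

lemma value_add (x : ℕ) : W.value S (fun y => φ y + φ' y) (fun y => r y + r' y) x
    = W.value S φ r x + W.value S φ' r' x := by
  have h : ∀ n x, W.stopValue S (fun y => φ y + φ' y) (fun y => r y + r' y) n x
      = W.stopValue S φ r n x + W.stopValue S φ' r' n x := by
    intro n
    induction n with
    | zero => intro x; simp [stopValue]
    | succ n ih =>
      intro x
      simp only [stopValue]
      split_ifs
      · rw [show W.stopValue S (fun y => φ y + φ' y) (fun y => r y + r' y) n
          = fun y => W.stopValue S φ r n y + W.stopValue S φ' r' n y from funext ih, op_add]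
        ring
      · rfl
  unfold value
  simp_rw [h]
  exact (ENNReal.iSup_add_iSup_of_monotone (W.stopValue_mono x) (W.stopValue_mono x)).symm

lemma value_const_mul (c : ℝ≥0∞) (x : ℕ) :
    W.value S (fun y => c * φ y) (fun y => c * r y) x = c * W.value S φ r x := by
  have h : ∀ n x, W.stopValue S (fun y => c * φ y) (fun y => c * r y) n x
      = c * W.stopValue S φ r n x := by
    intro n
    induction n with
    | zero => intro x; simp [stopValue]
    | succ n ih =>
      intro x
      simp only [stopValue]
      split_ifs
      · rw [show W.stopValue S (fun y => c * φ y) (fun y => c * r y) n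
          = fun y => c * W.stopValue S φ r n y from funext ih, op_const_mul]
        ring
      · rfl
  unfold value
  simp_rw [h, ENNReal.mul_iSup]

/-- `value` at a point of a region `R` depends only on the data in `R`, if the walk stays
in `R` until it leaves `S`. -/
lemma value_congr {R : Set ℕ} (hR : ∀ x ∈ R, x ∈ S → x + 1 ∈ R ∧ x - 1 ∈ R ∧ x - 2 ∈ R)
    (hS : ∀ x ∈ R, (x ∈ S ↔ x ∈ S')) (hφ : ∀ x ∈ R, x ∉ S → φ x = φ' x)
    (hr : ∀ x ∈ R, x ∈ S → r x = r' x) {x : ℕ} (hx : x ∈ R) :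
    W.value S φ r x = W.value S' φ' r' x := by
  unfold value
  refine iSup_congr fun n => ?_
  induction n generalizing x with
  | zero => rfl
  | succ n ih =>
    by_cases h : x ∈ S
    · obtain ⟨h1, h2, h3⟩ := hR x hx h
      rw [stopValue, stopValue, if_pos h, if_pos ((hS x hx).1 h), hr x hx h, op, op, ih h1, ih h2,
        ih h3]
    · rw [stopValue, stopValue, if_neg h, if_neg (fun h' => h ((hS x hx).2 h')), hφ x hx h]

/-! ### Survival probabilities and mean exit times. -/

open Classical in
/-- The probability that the walk stays in `S` at the times `0, …, n`. -/
def surv (S : Set ℕ) : ℕ → ℕ → ℝ≥0∞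
  | 0, x => if x ∈ S then 1 else 0
  | n + 1, x => if x ∈ S then W.op (surv S n) x else 0

/-- The expected time at which the walk leaves `S`. -/
def exitTime (S : Set ℕ) (x : ℕ) : ℝ≥0∞ := W.value S (fun _ => 0) (fun _ => 1) x

/-- The mean of a time is the sum of its tail probabilities; the truncated rewards are the partial
sums. -/
lemma tsum_surv (x : ℕ) : ∑' n, W.surv S n x = W.exitTime S x := by
  have h : ∀ n x, W.stopValue S (fun _ => 0) (fun _ => 1) n x
      = ∑ k ∈ Finset.range n, W.surv S k x := by
    intro n
    induction n with
    | zero => intro x; rfl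
    | succ n ih =>
      intro x
      rw [Finset.sum_range_succ']
      simp only [stopValue, surv]
      split_ifs
      · rw [show W.stopValue S (fun _ => 0) (fun _ => 1) n
          = fun y => ∑ k ∈ Finset.range n, W.surv S k y from funext ih, add_comm]
        congr 1
        simp only [op, Finset.mul_sum, Finset.sum_add_distrib]
      · simp
  unfold exitTime value
  simp_rw [h]
  exact ENNReal.tsum_eq_iSup_nat

lemma surv_tendsto_zero {x : ℕ} (h : W.exitTime S x < ∞) :
    Tendsto (fun n => W.surv S n x) atTop (𝓝 0) :=
  ENNReal.tendsto_atTop_zero_of_tsum_ne_top (by rw [tsum_surv]; exact h.ne)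

/-- Both terms refer to the times `0, …, n`: the walk has either left `S` by then or stayed
throughout. The index `n + 1` counts observation times. -/
lemma stopValue_add_surv (n x : ℕ) :
    W.stopValue S (fun _ => 1) (fun _ => 0) (n + 1) x + W.surv S n x = 1 := by
  induction n generalizing x with
  | zero =>
    simp only [stopValue, surv]
    split_ifs
    · simp [op]
    · simp
  | succ n ih =>
    rw [stopValue, surv]
    split_ifs
    · rw [zero_add, ← op_add]
      simp_rw [ih]
      exact W.op_const 1 x
    · simp

lemma surv_le_one (n x : ℕ) : W.surv S n x ≤ 1 := by
  rw [← W.stopValue_add_surv (S := S) n x]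
  exact le_add_self

/-- If the mean exit time is finite, the walk leaves `S` almost surely. -/
lemma value_one_of_exitTime_lt_top {x : ℕ} (h : W.exitTime S x < ∞) :
    W.value S (fun _ => 1) (fun _ => 0) x = 1 := by
  have h1 : Tendsto (fun n => W.stopValue S (fun _ => 1) (fun _ => 0) (n + 1) x) atTop
      (𝓝 (W.value S (fun _ => 1) (fun _ => 0) x)) :=
    (tendsto_add_atTop_iff_nat (f := fun n => W.stopValue S (fun _ => 1) (fun _ => 0) n x) 1).2
      (tendsto_atTop_iSup (W.stopValue_mono x))
  have h2 := h1.add (W.surv_tendsto_zero h)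
  simp_rw [stopValue_add_surv, add_zero] at h2
  exact tendsto_nhds_unique h2 tendsto_const_nhds

/-! ### Exit events and hitting times on path space. -/

lemma measurableSet_of_coordinates {p : ℕ → ℕ → Prop} (s : Set ℕ) :
    MeasurableSet {ω : ℕ → ℕ | ∀ k ∈ s, p k (ω k)} := by
  have : {ω : ℕ → ℕ | ∀ k ∈ s, p k (ω k)} = ⋂ k ∈ s, (fun ω => ω k) ⁻¹' {y | p k y} := by
    ext ω; simp
  rw [this]
  exact MeasurableSet.biInter s.to_countable fun k _ =>
    measurable_pi_apply (X := fun _ : ℕ => ℕ) k (MeasurableSet.of_discrete)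

lemma law_stay (n x : ℕ) : W.law x {ω | ∀ k ≤ n, ω k ∈ S} = W.surv S n x := by
  have hm : ∀ n, MeasurableSet {ω : ℕ → ℕ | ∀ k ≤ n, ω k ∈ S} := fun n =>
    measurableSet_of_coordinates (p := fun _ y => y ∈ S) (Set.Iic n)
  induction n generalizing x with
  | zero =>
    rw [W.law_apply (hm 0), surv]
    split_ifs with hx <;> simp [hx, op_const]
  | succ n ih =>
    rw [W.law_apply (hm (n + 1)), surv]
    split_ifs with hx
    · congr 1
      ext y
      rw [← ih]
      congr 1
      ext ω
      constructor
      · exact fun H k hk => H (k + 1) (by omega)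
      · rintro H (_ | k) hk
        · exact hx
        · exact H k (by omega)
    · have : ∀ y, W.law y (consPath x ⁻¹' {ω | ∀ k ≤ n + 1, ω k ∈ S}) = 0 := by
        intro y
        convert measure_empty (μ := W.law y)
        exact Set.eq_empty_of_forall_notMem fun ω H => hx (H 0 (by omega))
      simp_rw [this]
      exact W.op_const 0 x

lemma measurableSet_exit (S : Set ℕ) (b : ℤ) (m : ℕ) :
    MeasurableSet {ω : ℕ → ℕ | (∀ k < m, ω k ∈ S) ∧ ω m ∉ S ∧ (ω m : ℤ) = b} := by
  have h1 := measurableSet_of_coordinates (p := fun _ y => y ∈ S) (Set.Iio m)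
  have h2 := measurableSet_of_coordinates (p := fun _ y => y ∉ S ∧ (y : ℤ) = b) {m}
  convert h1.inter h2 using 1
  ext ω
  simp

/-- The indicator function of the integer `b`. -/
def delta (b : ℤ) (y : ℕ) : ℝ≥0∞ := if (y : ℤ) = b then 1 else 0

lemma law_exit (b : ℤ) (x : ℕ) :
    W.law x {ω | ∃ m : ℕ, (∀ k < m, ω k ∈ S) ∧ ω m ∉ S ∧ (ω m : ℤ) = b}
      = W.value S (delta b) (fun _ => 0) x := by
  have hm : ∀ n, MeasurableSet
      {ω : ℕ → ℕ | ∃ m < n, (∀ k < m, ω k ∈ S) ∧ ω m ∉ S ∧ (ω m : ℤ) = b} := by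
    intro n
    have : {ω : ℕ → ℕ | ∃ m < n, (∀ k < m, ω k ∈ S) ∧ ω m ∉ S ∧ (ω m : ℤ) = b}
        = ⋃ m ∈ Set.Iio n, {ω : ℕ → ℕ | (∀ k < m, ω k ∈ S) ∧ ω m ∉ S ∧ (ω m : ℤ) = b} := by
      ext ω; simp; grind
    rw [this]
    exact MeasurableSet.biUnion (Set.to_countable _) fun m _ => measurableSet_exit S b m
  have key : ∀ n x, W.law x {ω | ∃ m < n, (∀ k < m, ω k ∈ S) ∧ ω m ∉ S ∧ (ω m : ℤ) = b}
      = W.stopValue S (delta b) (fun _ => 0) n x := by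
    intro n
    induction n with
    | zero => intro x; simp [stopValue]
    | succ n ih =>
      intro x
      rw [W.law_apply (hm (n + 1)), stopValue]
      split_ifs with hx
      · rw [zero_add]
        congr 1
        ext y
        rw [← ih]
        congr 1
        ext ω
        constructor
        · rintro ⟨_ | m, hmn, h1, h2, h3⟩
          · exact absurd hx h2
          · exact ⟨m, by omega, fun k hk => h1 (k + 1) (by omega), h2, h3⟩
        · rintro ⟨m, hmn, h1, h2, h3⟩
          refine ⟨m + 1, by omega, ?_, h2, h3⟩
          rintro (_ | k) hk
          · exact hx
          · exact h1 k (by omega)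
      · have : ∀ y, W.law y (consPath x ⁻¹'
            {ω | ∃ m < n + 1, (∀ k < m, ω k ∈ S) ∧ ω m ∉ S ∧ (ω m : ℤ) = b}) = delta b x := by
          intro y
          by_cases hb : (x : ℤ) = b
          · rw [delta, if_pos hb]
            convert measure_univ (μ := W.law y)
            exact Set.eq_univ_of_forall fun ω => ⟨0, by omega, by simp, hx, hb⟩
          · rw [delta, if_neg hb]
            convert measure_empty (μ := W.law y)
            refine Set.eq_empty_of_forall_notMem fun ω => ?_
            rintro ⟨_ | m, hmn, h1, h2, h3⟩
            · exact hb h3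
            · exact hx (h1 0 (by omega))
        simp_rw [this]
        exact W.op_const _ x
  have hU : {ω : ℕ → ℕ | ∃ m : ℕ, (∀ k < m, ω k ∈ S) ∧ ω m ∉ S ∧ (ω m : ℤ) = b}
      = ⋃ n, {ω | ∃ m < n, (∀ k < m, ω k ∈ S) ∧ ω m ∉ S ∧ (ω m : ℤ) = b} := by
    ext ω
    simp only [Set.mem_iUnion]
    constructor
    · rintro ⟨m, h⟩
      exact ⟨m + 1, m, by omega, h⟩
    · rintro ⟨n, m, -, h⟩
      exact ⟨m, h⟩
  rw [hU, Monotone.measure_iUnion]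
  · simp_rw [key]
    rfl
  · rintro n n' hn ω ⟨m, hm, h⟩
    exact ⟨m, hm.trans_le hn, h⟩

lemma exitProb_eq (x : ℕ) (S : Set ℕ) (b : ℤ) :
    W.exitProb x S b = (W.value S (delta b) (fun _ => 0) x).toReal := by
  rw [exitProb, Measure.real, law_exit]

lemma value_delta_le_one (b : ℤ) (x : ℕ) : W.value S (delta b) (fun _ => 0) x ≤ 1 := by
  rw [← law_exit]; exact prob_le_one

/-- The tail-sum formula along a single path. The leading `1` is there because the search starts at
time `1`; if `B` is never hit, all indicators are `1` and both sides are infinite. -/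
lemma coe_hittingAfter_eq_tsum (B : Set ℕ) (ω : ℕ → ℕ) :
    ENat.toENNReal (hittingAfter (fun n (ω : ℕ → ℕ) => ω n) B 1 ω)
      = 1 + ∑' n, Set.indicator {ω : ℕ → ℕ | ∀ k ≤ n, ω (k + 1) ∉ B} (fun _ => (1 : ℝ≥0∞)) ω := by
  classical
  rw [hittingAfter_def]
  dsimp only
  split_ifs with h
  · set s := {i : ℕ | 1 ≤ i ∧ ω i ∈ B} with hs
    have hne : s.Nonempty := h
    have hmem : sInf s ∈ s := Nat.sInf_mem hne
    have h1 : ∀ n, Set.indicator {ω : ℕ → ℕ | ∀ k ≤ n, ω (k + 1) ∉ B} (fun _ => (1 : ℝ≥0∞)) ω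
        = if n ∈ Finset.range (sInf s - 1) then 1 else 0 := by
      intro n
      rw [Set.indicator_apply]
      refine if_congr ?_ rfl rfl
      rw [Finset.mem_range]
      constructor
      · intro H
        by_contra hn
        refine H (sInf s - 1) (by omega) ?_
        rw [Nat.sub_add_cancel hmem.1]
        exact hmem.2
      · intro H k hk hB
        have : sInf s ≤ k + 1 := Nat.sInf_le ⟨by omega, hB⟩
        omega
    simp_rw [h1]
    rw [tsum_eq_sum (s := Finset.range (sInf s - 1)) (fun b hb => if_neg hb),
      Finset.sum_congr rfl (fun n hn => if_pos hn)]
    have h2 : sInf s = 1 + (sInf s - 1) := by have := hmem.1; omega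
    have h3 : ((sInf s : ℕ) : ℝ≥0∞) = 1 + ((sInf s - 1 : ℕ) : ℝ≥0∞) := by
      conv_lhs => rw [h2]
      push_cast
      rfl
    rw [Finset.sum_const, Finset.card_range, nsmul_one, ← h3]
    exact ENat.toENNReal_coe _
  · push Not at h
    have h1 : ∀ n, Set.indicator {ω : ℕ → ℕ | ∀ k ≤ n, ω (k + 1) ∉ B} (fun _ => (1 : ℝ≥0∞)) ω
        = 1 := by
      intro n
      exact Set.indicator_of_mem (s := {ω : ℕ → ℕ | ∀ k ≤ n, ω (k + 1) ∉ B})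
        (fun k _ => h (k + 1) (by omega)) _
    simp_rw [h1]
    rw [ENNReal.tsum_const_eq_top_of_ne_zero one_ne_zero, add_top]
    exact ENat.toENNReal_top

/-- Mean hitting times and mean exit times of the complement. -/
lemma lintegral_hittingAfter (B : Set ℕ) (x : ℕ) :
    ∫⁻ ω, ENat.toENNReal (hittingAfter (fun n (ω : ℕ → ℕ) => ω n) B 1 ω) ∂W.law x
      = 1 + W.op (W.exitTime Bᶜ) x := by
  have hm : ∀ n, MeasurableSet {ω : ℕ → ℕ | ∀ k ≤ n, ω (k + 1) ∉ B} := by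
    intro n
    have := measurableSet_of_coordinates (p := fun _ y => y ∉ B) (Set.Icc 1 (n + 1))
    convert this using 1
    ext ω
    constructor
    · rintro H (_ | k) hk
      · exact absurd hk.1 (by omega)
      · exact H k (by have := hk.2; omega)
    · exact fun H k hk => H (k + 1) ⟨by omega, by omega⟩
  simp_rw [coe_hittingAfter_eq_tsum]
  rw [lintegral_add_left measurable_const,
    lintegral_tsum fun n => (measurable_const.indicator (hm n)).aemeasurable]
  have : W.exitTime Bᶜ = fun y => ∑' n, W.surv Bᶜ n y := by
    ext y; rw [tsum_surv]
  rw [this, op_tsum]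
  congr 1
  · simp
  refine tsum_congr fun n => ?_
  rw [lintegral_indicator_const (hm n), one_mul, W.law_apply (hm n)]
  congr 1
  ext y
  rw [← law_stay]
  rfl

lemma meanT_eq (x j : ℕ) : W.meanT x j = 1 + W.op (W.exitTime {j}ᶜ) x :=
  W.lintegral_hittingAfter {j} x

lemma meanTau_eq (x : ℕ) {j : ℕ} (hj : 1 ≤ j) :
    W.meanTau x j = 1 + W.op (W.exitTime (Set.Ici j)) x := by
  have := W.lintegral_hittingAfter (Set.Iio j) x
  rw [Set.compl_Iio] at this
  rw [← this, meanTau]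
  refine lintegral_congr fun ω => ?_
  have : tau j = hittingAfter (fun n (ω : ℕ → ℕ) => ω n) (Set.Iio j) 1 := if_neg (by omega)
  rw [this]

lemma exitTime_of_mem {x : ℕ} (hx : x ∈ S) : W.exitTime S x = 1 + W.op (W.exitTime S) x :=
  W.value_of_mem hx

lemma exitTime_of_notMem {x : ℕ} (hx : x ∉ S) : W.exitTime S x = 0 :=
  W.value_of_notMem hx

lemma meanT_eq_exitTime {x j : ℕ} (h : x ≠ j) : W.meanT x j = W.exitTime {j}ᶜ x := by
  rw [meanT_eq, W.exitTime_of_mem (by simpa using h)]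

lemma meanTau_eq_exitTime {j : ℕ} (hj : 1 ≤ j) :
    W.meanTau j j = W.exitTime (Set.Ici j) j := by
  rw [W.meanTau_eq j hj, W.exitTime_of_mem Set.self_mem_Ici]

/-! ### Descents below the starting level. -/

/-- The probability that the walk started at `k` leaves `{k, k+1, …}` at `k - 1`. -/
def downOne (k : ℕ) : ℝ≥0∞ := W.value (Set.Ici k) (delta ((k : ℤ) - 1)) (fun _ => 0) k

/-- The probability that the walk started at `k` leaves `{k, k+1, …}` at `k - 2`. -/
def downTwo (k : ℕ) : ℝ≥0∞ := W.value (Set.Ici k) (delta ((k : ℤ) - 2)) (fun _ => 0) k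

lemma downOne_lt_top (k : ℕ) : W.downOne k < ∞ :=
  (W.value_delta_le_one _ _).trans_lt ENNReal.one_lt_top

lemma downTwo_lt_top (k : ℕ) : W.downTwo k < ∞ :=
  (W.value_delta_le_one _ _).trans_lt ENNReal.one_lt_top

lemma value_zero (x : ℕ) : W.value S (fun _ => 0) (fun _ => 0) x = 0 := by
  simpa using W.value_const_mul (S := S) (φ := fun _ => 0) (r := fun _ => 0) 0 x

/-- Only `k - 1` and `k - 2` can be exit points, so `φ` may be replaced by a combination of two
indicators, and linearity applies. -/
lemma value_Ici {k : ℕ} (hk : 1 ≤ k) :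
    W.value (Set.Ici k) φ r k = W.value (Set.Ici k) (fun _ => 0) r k
      + (W.downOne k * φ (k - 1) + W.downTwo k * φ (k - 2)) := by
  have h : W.value (Set.Ici k) φ r k = W.value (Set.Ici k)
      (fun y => 0 + (φ (k - 1) * delta ((k : ℤ) - 1) y + φ (k - 2) * delta ((k : ℤ) - 2) y))
      (fun y => r y + (φ (k - 1) * 0 + φ (k - 2) * 0)) k := by
    refine W.value_congr (R := {y | k ≤ y + 2}) ?_ (fun _ _ => Iff.rfl) ?_ ?_ ?_
    · intro x hx hx'
      simp only [Set.mem_ofPred_eq, Set.mem_Ici] at *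
      omega
    · intro x hx hx'
      simp only [Set.mem_ofPred_eq, Set.mem_Ici, not_le] at hx hx'
      unfold delta
      -- For `k = 1` the truncated `k - 2` coincides with `k - 1`, but the indicator of the integer
      -- `-1` vanishes on states, so nothing is counted twice.
      rcases (by omega : x = k - 1 ∨ (x = k - 2 ∧ 2 ≤ k)) with h | ⟨h, h2⟩
      · rw [if_pos (by omega), if_neg (by omega), h]
        simp
      · rw [if_neg (by omega), if_pos (by omega), h]
        simp
    · intro x _ _
      simp
    · simp
  rw [h, value_add, value_add, value_const_mul, value_const_mul, downOne, downTwo]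
  ring

/-- The strong Markov property at the time when the walk started at `k` first is below `k`. -/
lemma value_eq_of_Ici_subset {k : ℕ} (hk : 1 ≤ k) (h : Set.Ici k ⊆ S) :
    W.value S φ r k = W.value (Set.Ici k) (fun _ => 0) r k
      + (W.downOne k * W.value S φ r (k - 1) + W.downTwo k * W.value S φ r (k - 2)) := by
  rw [W.value_eq_value_of_subset h k, W.value_Ici hk]

lemma exitTime_eq_of_Ici_subset {k : ℕ} (hk : 1 ≤ k) (h : Set.Ici k ⊆ S) :
    W.exitTime S k = W.exitTime (Set.Ici k) k
      + (W.downOne k * W.exitTime S (k - 1) + W.downTwo k * W.exitTime S (k - 2)) :=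
  W.value_eq_of_Ici_subset hk h

lemma downOne_add_downTwo {k : ℕ} (hk : 1 ≤ k) (h : W.exitTime (Set.Ici k) k < ∞) :
    W.downOne k + W.downTwo k = 1 := by
  have := W.value_one_of_exitTime_lt_top h
  rw [W.value_Ici hk, value_zero] at this
  simpa using this

/-- A first-step decomposition in which an upward step is followed until the walk is below `k + 1`.
It is then at `k`, where the value recurs, or at `k - 1`, where it has left. -/
lemma value_Ici_step {k : ℕ} (hk : 1 ≤ k) :
    W.value (Set.Ici k) φ r k = r k
      + (ENNReal.ofReal (W.p k) * (W.value (Set.Ici (k + 1)) (fun _ => 0) r (k + 1)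
          + (W.downOne (k + 1) * W.value (Set.Ici k) φ r k + W.downTwo (k + 1) * φ (k - 1)))
        + ENNReal.ofReal (W.q₁ k) * φ (k - 1) + ENNReal.ofReal (W.q₂ k) * φ (k - 2)) := by
  conv_lhs => rw [W.value_of_mem Set.self_mem_Ici, op,
    W.value_eq_of_Ici_subset (k := k + 1) (by omega) (Set.Ici_subset_Ici.2 (by omega))]
  have h1 : W.value (Set.Ici k) φ r (k - 1) = φ (k - 1) :=
    W.value_of_notMem (by simp only [Set.mem_Ici, not_le]; omega)
  have h2 : W.value (Set.Ici k) φ r (k - 2) = φ (k - 2) :=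
    W.value_of_notMem (by simp only [Set.mem_Ici, not_le]; omega)
  rw [h1, h2, Nat.add_sub_cancel, show k + 1 - 2 = k - 1 by omega, h1]

lemma exitTime_Ici_eq {k : ℕ} (hk : 1 ≤ k) :
    W.exitTime (Set.Ici k) k = 1 + ENNReal.ofReal (W.p k) *
      (W.exitTime (Set.Ici (k + 1)) (k + 1) + W.downOne (k + 1) * W.exitTime (Set.Ici k) k) := by
  have := W.value_Ici_step (φ := fun _ => 0) (r := fun _ => 1) hk
  simpa [exitTime] using this

lemma downOne_eq {k : ℕ} (hk : 2 ≤ k) :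
    W.downOne k = ENNReal.ofReal (W.p k) * (W.downOne (k + 1) * W.downOne k + W.downTwo (k + 1))
      + ENNReal.ofReal (W.q₁ k) := by
  have := W.value_Ici_step (φ := delta ((k : ℤ) - 1)) (r := fun _ => 0) (k := k) (by omega)
  rw [value_zero, show delta ((k : ℤ) - 1) (k - 1) = 1 from if_pos (by omega),
    show delta ((k : ℤ) - 1) (k - 2) = 0 from if_neg (by omega)] at this
  change W.downOne k = _ + (_ * (_ + (_ * W.downOne k + _)) + _ + _) at this
  simpa using this

lemma downTwo_eq {k : ℕ} (hk : 2 ≤ k) :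
    W.downTwo k = ENNReal.ofReal (W.p k) * (W.downOne (k + 1) * W.downTwo k)
      + ENNReal.ofReal (W.q₂ k) := by
  have := W.value_Ici_step (φ := delta ((k : ℤ) - 2)) (r := fun _ => 0) (k := k) (by omega)
  rw [value_zero, show delta ((k : ℤ) - 2) (k - 1) = 0 from if_neg (by omega),
    show delta ((k : ℤ) - 2) (k - 2) = 1 from if_pos (by omega)] at this
  change W.downTwo k = _ + (_ * (_ + (_ * W.downTwo k + _)) + _ + _) at this
  simpa using this

/-! ### Finiteness of the mean times, and upward passages. -/

lemma p_pos' (i : ℕ) : 0 < W.p i := by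
  rcases Nat.eq_zero_or_pos i with rfl | h
  · rw [W.p_zero]; exact one_pos
  · exact W.p_pos i h

lemma q₁_zero : W.q₁ 0 = 0 := by
  linarith [W.sum_eq_one 0, W.p_zero, W.q₁_nonneg 0, W.q₂_nonneg 0]

lemma q₂_zero : W.q₂ 0 = 0 := by
  linarith [W.sum_eq_one 0, W.p_zero, W.q₁_nonneg 0, W.q₂_nonneg 0]

/-- An infinite mean at `k + 1` would force an infinite mean at `k`, as level `k + 1` is reached in
one step with positive probability. -/
lemma exitTime_Ici_lt_top (h : W.exitTime (Set.Ici 1) 1 < ∞) {k : ℕ} (hk : 1 ≤ k) :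
    W.exitTime (Set.Ici k) k < ∞ := by
  induction k, hk using Nat.le_induction with
  | base => exact h
  | succ k hk ih =>
    by_contra hne
    rw [not_lt, top_le_iff] at hne
    have := W.exitTime_Ici_eq hk
    rw [hne, top_add, ENNReal.mul_top (by simpa using W.p_pos' k), add_top] at this
    exact ih.ne this

/-- From any state, the mean time to leave `{0, …, j - 1}` is finite. -/
lemma exitTime_Iio_lt_top (j x : ℕ) : W.exitTime (Set.Iio j) x < ∞ := by
  induction j generalizing x with
  | zero =>
    rw [W.exitTime_of_notMem (by simp)]
    exact ENNReal.zero_lt_top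
  | succ j ih =>
    set e := W.exitTime (Set.Iio j)
    have hp0 : ENNReal.ofReal (W.p j) ≠ 0 := by simpa using W.p_pos' j
    -- The supersolution on `{0, …, j}` is `e + C`. Since `e j = 0`, its equation at `j` reads `p(j)
    -- C = 1 + q₁(j) e(j-1) + q₂(j) e(j-2)`, which fixes `C`.
    set C : ℝ≥0∞ := (1 + (ENNReal.ofReal (W.q₁ j) * e (j - 1) + ENNReal.ofReal (W.q₂ j) * e (j - 2)))
      / ENNReal.ofReal (W.p j) with hC
    have hCp : ENNReal.ofReal (W.p j) * C
        = 1 + (ENNReal.ofReal (W.q₁ j) * e (j - 1) + ENNReal.ofReal (W.q₂ j) * e (j - 2)) :=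
      ENNReal.mul_div_cancel hp0 ENNReal.ofReal_ne_top
    have hCtop : C < ∞ := by
      refine ENNReal.div_lt_top ?_ hp0
      exact ENNReal.add_ne_top.2 ⟨ENNReal.one_ne_top, ENNReal.add_ne_top.2
        ⟨ENNReal.mul_ne_top ENNReal.ofReal_ne_top (ih _).ne,
          ENNReal.mul_ne_top ENNReal.ofReal_ne_top (ih _).ne⟩⟩
    have key : W.exitTime (Set.Iio (j + 1)) x ≤ if x ≤ j then e x + C else 0 := by
      refine W.value_le (f := fun z => if z ≤ j then e z + C else 0) (fun y hy => ?_)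
        (fun _ _ => zero_le) x
      have hy' : y ≤ j := by simpa [Nat.lt_succ_iff] using hy
      rw [if_pos hy']
      rcases Nat.lt_or_ge y j with hlt | hge
      · have : W.op (fun z => if z ≤ j then e z + C else 0) y = W.op (fun z => e z + C) y := by
          simp only [op, if_pos (show y + 1 ≤ j by omega), if_pos (show y - 1 ≤ j by omega),
            if_pos (show y - 2 ≤ j by omega)]
        rw [this, op_add, op_const, ← add_assoc, ← W.exitTime_of_mem (S := Set.Iio j) hlt]
      · obtain rfl : y = j := le_antisymm hy' hge
        have h0 : e y = 0 := W.exitTime_of_notMem (by simp)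
        rw [h0, zero_add]
        simp only [op, if_neg (show ¬ y + 1 ≤ y by omega), if_pos (show y - 1 ≤ y by omega),
            if_pos (show y - 2 ≤ y by omega)]
        apply le_of_eq
        calc _ = (1 + (ENNReal.ofReal (W.q₁ y) * e (y - 1) + ENNReal.ofReal (W.q₂ y) * e (y - 2)))
              + (ENNReal.ofReal (W.q₁ y) + ENNReal.ofReal (W.q₂ y)) * C := by ring
          _ = (ENNReal.ofReal (W.p y) + ENNReal.ofReal (W.q₁ y) + ENNReal.ofReal (W.q₂ y)) * C := by
              rw [← hCp]; ring
          _ = C := by rw [ofReal_sum_eq_one, one_mul]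
    refine key.trans_lt ?_
    split_ifs
    · exact ENNReal.add_lt_top.2 ⟨ih x, hCtop⟩
    · exact ENNReal.zero_lt_top

/-- From `x ≤ j` the walk can exceed `j` only through `j`, which it reaches almost surely; the
strong Markov property at that time splits the mean. -/
lemma exitTime_Iio_succ {j x : ℕ} (hx : x ≤ j) :
    W.exitTime (Set.Iio (j + 1)) x
      = W.exitTime (Set.Iio j) x + W.exitTime (Set.Iio (j + 1)) j := by
  set c := W.exitTime (Set.Iio (j + 1)) j with hc
  have h1 := W.value_eq_value_of_subset (S' := Set.Iio j) (S := Set.Iio (j + 1))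
    (φ := fun _ => 0) (r := fun _ => 1) (Set.Iio_subset_Iio (by omega)) x
  have h2 : W.value (Set.Iio j) (W.value (Set.Iio (j + 1)) (fun _ => 0) fun _ => 1) (fun _ => 1) x
      = W.value (Set.Iio j) (fun y => 0 + c * 1) (fun y => 1 + c * 0) x := by
    refine W.value_congr (R := Set.Iic j) ?_ (fun _ _ => Iff.rfl) ?_ ?_ hx
    · intro y _ hy
      simp only [Set.mem_Iio, Set.mem_Iic] at *
      omega
    · intro y hy hy'
      obtain rfl : y = j := by
        simp only [Set.mem_Iio, Set.mem_Iic] at *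
        omega
      simp [hc, exitTime]
    · simp
  rw [h2, value_add, value_const_mul,
    W.value_one_of_exitTime_lt_top (W.exitTime_Iio_lt_top j x), mul_one] at h1
  exact h1

lemma exitTime_compl_singleton {j x : ℕ} (hx : x ≤ j) :
    W.exitTime {j}ᶜ x = W.exitTime (Set.Iio j) x := by
  refine W.value_congr (R := Set.Iic j) ?_ ?_ (fun _ _ _ => rfl) (fun _ _ _ => rfl) hx
  · intro y hy hy'
    simp only [Set.mem_compl_iff, Set.mem_singleton_iff, Set.mem_Iic] at *
    omega
  · intro y hy
    simp only [Set.mem_compl_iff, Set.mem_singleton_iff, Set.mem_Iic, Set.mem_Iio] at *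
    omega

lemma meanT_succ_eq (i : ℕ) : W.meanT i (i + 1) = W.exitTime (Set.Iio (i + 1)) i := by
  rw [W.meanT_eq_exitTime (by omega), W.exitTime_compl_singleton (by omega)]

lemma meanT_succ_lt_top (i : ℕ) : W.meanT i (i + 1) < ∞ := by
  rw [meanT_succ_eq]; exact W.exitTime_Iio_lt_top _ _

lemma exitTime_Iio_add_two (i : ℕ) :
    W.exitTime (Set.Iio (i + 2)) i = W.meanT i (i + 1) + W.meanT (i + 1) (i + 2) := by
  rw [W.exitTime_Iio_succ (by omega), meanT_succ_eq, meanT_succ_eq]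

lemma exitTime_Iio_add_three (i : ℕ) :
    W.exitTime (Set.Iio (i + 3)) i
      = W.meanT i (i + 1) + W.meanT (i + 1) (i + 2) + W.meanT (i + 2) (i + 3) := by
  rw [W.exitTime_Iio_succ (by omega), exitTime_Iio_add_two, W.meanT_succ_eq (i + 2)]

lemma meanT_succ_step (i : ℕ) : W.meanT i (i + 1)
    = 1 + (ENNReal.ofReal (W.q₁ i) * W.exitTime (Set.Iio (i + 1)) (i - 1)
      + ENNReal.ofReal (W.q₂ i) * W.exitTime (Set.Iio (i + 1)) (i - 2)) := by
  rw [meanT_succ_eq, W.exitTime_of_mem (by simp), op,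
    W.exitTime_of_notMem (x := i + 1) (by simp), mul_zero, zero_add]

/-- Above `i`, each descent below the current starting level has finite mean and ends at a smaller
state without jumping past `i` unless it lands below it; strong induction on the state handles both
endpoints. -/
lemma exitTime_compl_singleton_lt_top (h : W.exitTime (Set.Ici 1) 1 < ∞) (i x : ℕ) :
    W.exitTime {i}ᶜ x < ∞ := by
  induction x using Nat.strong_induction_on with
  | _ x ih =>
    rcases Nat.lt_or_ge i x with hx | hx
    · rw [W.exitTime_eq_of_Ici_subset (k := x) (by omega)]
      · refine ENNReal.add_lt_top.2 ⟨W.exitTime_Ici_lt_top h (by omega), ENNReal.add_lt_top.2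
          ⟨ENNReal.mul_lt_top (W.downOne_lt_top x) (ih _ (by omega)),
            ENNReal.mul_lt_top (W.downTwo_lt_top x) (ih _ (by omega))⟩⟩
      · intro y hy
        simp only [Set.mem_compl_iff, Set.mem_singleton_iff, Set.mem_Ici] at *
        omega
    · rw [W.exitTime_compl_singleton hx]
      exact W.exitTime_Iio_lt_top i x

lemma op_lt_top {f : ℕ → ℝ≥0∞} (hf : ∀ x, f x < ∞) (x : ℕ) : W.op f x < ∞ := by
  unfold op
  exact ENNReal.add_lt_top.2 ⟨ENNReal.add_lt_top.2
    ⟨ENNReal.mul_lt_top ENNReal.ofReal_lt_top (hf _),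
      ENNReal.mul_lt_top ENNReal.ofReal_lt_top (hf _)⟩,
    ENNReal.mul_lt_top ENNReal.ofReal_lt_top (hf _)⟩

lemma toReal_op {f : ℕ → ℝ≥0∞} (hf : ∀ x, f x < ∞) (x : ℕ) :
    (W.op f x).toReal = W.p x * (f (x + 1)).toReal + W.q₁ x * (f (x - 1)).toReal
      + W.q₂ x * (f (x - 2)).toReal := by
  have h := fun (c : ℝ) y => (ENNReal.mul_lt_top (ENNReal.ofReal_lt_top (r := c)) (hf y)).ne
  unfold op
  rw [ENNReal.toReal_add (ENNReal.add_ne_top.2 ⟨h _ _, h _ _⟩) (h _ _),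
    ENNReal.toReal_add (h _ _) (h _ _), ENNReal.toReal_mul, ENNReal.toReal_mul, ENNReal.toReal_mul,
    ENNReal.toReal_ofReal (W.p_nonneg x), ENNReal.toReal_ofReal (W.q₁_nonneg x),
    ENNReal.toReal_ofReal (W.q₂_nonneg x)]

lemma meanT_self_lt_top (h : W.exitTime (Set.Ici 1) 1 < ∞) (i : ℕ) : W.meanT i i < ∞ := by
  rw [meanT_eq]
  exact ENNReal.add_lt_top.2 ⟨ENNReal.one_lt_top,
    W.op_lt_top (W.exitTime_compl_singleton_lt_top h i) i⟩

/-! ### The mean return time. -/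

lemma exitProb_Ici_sub_one (k : ℕ) :
    W.exitProb k (Set.Ici k) ((k : ℤ) - 1) = (W.downOne k).toReal := W.exitProb_eq _ _ _

lemma exitProb_Ici_sub_two (k : ℕ) :
    W.exitProb k (Set.Ici k) ((k : ℤ) - 2) = (W.downTwo k).toReal := W.exitProb_eq _ _ _

lemma exitProb_Ici_succ_sub_one (k : ℕ) :
    W.exitProb (k + 1) (Set.Ici (k + 1)) ((k : ℤ) - 1) = (W.downTwo (k + 1)).toReal := by
  rw [← exitProb_Ici_sub_two]
  congr 1
  push_cast
  ring

lemma exitProb_Ici_succ_self (k : ℕ) :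
    W.exitProb (k + 1) (Set.Ici (k + 1)) (k : ℤ) = (W.downOne (k + 1)).toReal := by
  rw [← exitProb_Ici_sub_one]
  congr 1
  push_cast
  ring

lemma downTwo_one : W.downTwo 1 = 0 := by
  have : delta (((1 : ℕ) : ℤ) - 2) = fun _ => 0 := by
    ext y
    rw [delta, if_neg (by omega)]
  rw [downTwo, this, value_zero]

/-- The mean return time. -/
lemma toReal_meanT_self (h : W.exitTime (Set.Ici 1) 1 < ∞) (i : ℕ) :
    (W.meanT i i).toReal = W.returnFormula i := by
  have hf := W.exitTime_compl_singleton_lt_top h i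
  have hh := fun k => W.exitTime_Ici_lt_top h (k := k + 1) (by omega)
  rw [meanT_eq, ENNReal.toReal_add ENNReal.one_ne_top (W.op_lt_top hf i).ne, toReal_op _ hf,
    returnFormula, W.meanTau_eq_exitTime (by omega), exitProb_Ici_succ_sub_one,
    W.exitTime_eq_of_Ici_subset (k := i + 1) (S := {i}ᶜ) (by omega)
      (fun y hy => by simp only [Set.mem_compl_iff, Set.mem_singleton_iff, Set.mem_Ici] at *; omega)]
  rw [Nat.add_sub_cancel, W.exitTime_of_notMem (S := {i}ᶜ) (x := i) (by simp), mul_zero, zero_add,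
    ENNReal.toReal_add (hh i).ne (ENNReal.mul_lt_top (W.downTwo_lt_top _) (hf _)).ne,
    ENNReal.toReal_mul, show i + 1 - 2 = i - 1 by omega, ENNReal.toReal_one]
  -- States `0` and `1` are separate because of the truncated subtraction: from `1` both downward
  -- jumps end at `0`, and `meanUp (-1) = 0`. From `i ≥ 2`, the passage from `i - 2` to `i` splits
  -- at `i - 1`.
  rcases i with _ | _ | i
  · rw [q₁_zero, q₂_zero, zero_add, downTwo_one]
    simp [add_comm]
  · have h1 : W.meanUp (((0 + 1 : ℕ) : ℤ) - 1) = W.exitTime {0 + 1}ᶜ 0 := by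
      rw [meanUp, if_pos (by norm_num), ← W.meanT_eq_exitTime (by omega)]
      norm_num
    have h2 : W.meanUp (((0 + 1 : ℕ) : ℤ) - 2) = 0 := if_neg (by norm_num)
    rw [h1, h2, show 0 + 1 - 1 = 0 from rfl, ENNReal.toReal_zero]
    ring
  · have h1 : W.meanUp (((i + 1 + 1 : ℕ) : ℤ) - 1) = W.meanT (i + 1) (i + 2) := by
      rw [show ((i + 1 + 1 : ℕ) : ℤ) - 1 = ((i + 1 : ℕ) : ℤ) by push_cast; ring, meanUp,
        if_pos (by positivity), Int.toNat_natCast]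
    have h2 : W.meanUp (((i + 1 + 1 : ℕ) : ℤ) - 2) = W.meanT i (i + 1) := by
      rw [show ((i + 1 + 1 : ℕ) : ℤ) - 2 = (i : ℤ) by push_cast; ring, meanUp,
        if_pos (by positivity), Int.toNat_natCast]
    have h3 : W.exitTime {i + 1 + 1}ᶜ (i + 1) = W.meanT (i + 1) (i + 2) :=
      (W.meanT_eq_exitTime (by omega)).symm
    have h4 : W.exitTime {i + 1 + 1}ᶜ i = W.meanT i (i + 1) + W.meanT (i + 1) (i + 2) := by
      rw [W.exitTime_compl_singleton (by omega), exitTime_Iio_add_two]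
    rw [h1, h2, show i + 1 + 1 - 1 = i + 1 from rfl, show i + 1 + 1 - 2 = i from rfl, h3, h4,
      ENNReal.toReal_add (W.meanT_succ_lt_top _).ne (W.meanT_succ_lt_top _).ne]
    ring

/-! ### Ordered matrix products. -/

section Products

variable {m : ℕ} (A : ℕ → Matrix (Fin m) (Fin m) ℝ)

lemma descProd_self (i : ℕ) : descProd A i i = A i := by
  simp [descProd]

lemma descProd_succ {i k : ℕ} (h : i ≤ k + 1) :
    descProd A (k + 1) i = A (k + 1) * descProd A k i := by
  unfold descProd
  rw [show k + 1 + 1 - i = (k + 1 - i) + 1 by omega, List.range'_concat, List.reverse_append,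
    List.map_append, List.prod_append]
  simp [show i + (k + 1 - i) = k + 1 by omega]

lemma ascProd_self (i : ℕ) : ascProd A i i = A i := by
  simp [ascProd]

lemma ascProd_succ {i k : ℕ} (h : i ≤ k) : ascProd A i k = A i * ascProd A (i + 1) k := by
  unfold ascProd
  rw [show k + 1 - i = (k + 1 - (i + 1)) + 1 by omega, List.range'_succ]
  simp

lemma matrix_mul_nonneg {B C : Matrix (Fin m) (Fin m) ℝ} (hB : ∀ a b, 0 ≤ B a b)
    (hC : ∀ a b, 0 ≤ C a b) (a b : Fin m) : 0 ≤ (B * C) a b := by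
  rw [Matrix.mul_apply]
  exact Finset.sum_nonneg fun c _ => mul_nonneg (hB _ _) (hC _ _)

variable {A}

lemma descProd_nonneg {i k : ℕ} (hik : i ≤ k) (hA : ∀ j a b, 0 ≤ A j a b) (a b : Fin m) :
    0 ≤ descProd A k i a b := by
  induction k, hik using Nat.le_induction generalizing a b with
  | base => rw [descProd_self]; exact hA _ _ _
  | succ k hk ih =>
    rw [descProd_succ A (by omega)]
    exact matrix_mul_nonneg (hA _) ih a b

lemma ascProd_nonneg {i : ℕ} (n : ℕ) (hA : ∀ j, i ≤ j → ∀ a b, 0 ≤ A j a b) (a b : Fin m) :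
    0 ≤ ascProd A i (i + n) a b := by
  induction n generalizing i a b with
  | zero => rw [add_zero, ascProd_self]; exact hA _ le_rfl _ _
  | succ n ih =>
    rw [ascProd_succ A (by omega), show i + (n + 1) = i + 1 + n by omega]
    exact matrix_mul_nonneg (hA _ le_rfl) (ih fun j hj => hA j (by omega)) a b

end Products

/-! ### Exit probabilities from finite and infinite intervals. -/

lemma Mtilde_nonneg (j : ℕ) (a b : Fin 2) : 0 ≤ W.Mtilde j a b := by
  have h1 := W.q₁_nonneg j
  have h2 := W.q₂_nonneg j
  have h3 := W.p_nonneg j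
  fin_cases a <;> fin_cases b <;> simp [Mtilde] <;> positivity

/-- The sum of the products of the matrices `M̃_k`, applied to the increments of a function that is
harmonic on `{i, …, n}`. -/
lemma exitSum_mulVec_of_harmonic {f : ℕ → ℝ} {j n : ℕ} (hn : j + 2 ≤ n)
    (hf : ∀ x ∈ Set.Icc (j + 2) n,
      f x = W.p x * f (x + 1) + W.q₁ x * f (x - 1) + W.q₂ x * f (x - 2)) :
    ![1, 0] ⬝ᵥ W.exitSum (j + 2) n *ᵥ ![f (j + 1) - f (j + 2), f j - f (j + 1)]
      = f (j + 2) - f (n + 1) := by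
  -- Harmonicity at `y` rearranges to `p(y)(f(y) - f(y+1)) = (q₁(y) + q₂(y))(f(y-1) - f(y)) +
  -- q₂(y)(f(y-2) - f(y-1))`, the first row of `M̃_y`.
  have step : ∀ x, x + 2 ∈ Set.Icc (j + 2) n →
      W.Mtilde (x + 2) *ᵥ ![f (x + 1) - f (x + 2), f x - f (x + 1)]
        = ![f (x + 2) - f (x + 3), f (x + 1) - f (x + 2)] := by
    intro x hx
    have h := hf _ hx
    have hp := (W.p_pos' (x + 2)).ne'
    have hs := W.sum_eq_one (x + 2)
    simp only [show x + 2 + 1 = x + 3 from rfl, show x + 2 - 1 = x + 1 from rfl,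
      Nat.add_sub_cancel] at h
    ext a
    fin_cases a
    · simp [Mtilde, Matrix.mulVec, dotProduct, Fin.sum_univ_two]
      field_simp
      linear_combination -f (x + 2) * hs - h
    · simp [Mtilde, Matrix.mulVec, dotProduct, Fin.sum_univ_two]
  have prod : ∀ k, j + 2 + k ≤ n →
      descProd W.Mtilde (j + 2 + k) (j + 2) *ᵥ ![f (j + 1) - f (j + 2), f j - f (j + 1)]
        = ![f (j + 2 + k) - f (j + 3 + k), f (j + 1 + k) - f (j + 2 + k)] := by
    intro k
    induction k with
    | zero =>
      intro hk
      rw [add_zero, descProd_self]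
      exact step j ⟨le_rfl, hn⟩
    | succ k ih =>
      intro hk
      rw [show j + 2 + (k + 1) = j + 2 + k + 1 by omega, descProd_succ _ (by omega),
        ← Matrix.mulVec_mulVec, ih (by omega)]
      have := step (j + k + 1) ⟨by omega, by omega⟩
      rw [show j + k + 1 + 2 = j + 2 + k + 1 by omega, show j + k + 1 + 1 = j + 2 + k by omega,
        show j + k + 1 + 3 = j + 3 + (k + 1) by omega, show j + k + 1 = j + 1 + k by omega] at this
      rw [show j + 3 + k = j + 2 + k + 1 by omega, this,
        show j + 1 + (k + 1) = j + 2 + k by omega]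
  rw [exitSum, Matrix.sum_mulVec, dotProduct_sum]
  have hterm : ∀ k ∈ Finset.Icc (j + 2) n, ![1, 0] ⬝ᵥ
      descProd W.Mtilde k (j + 2) *ᵥ ![f (j + 1) - f (j + 2), f j - f (j + 1)]
        = f k - f (k + 1) := by
    intro k hk
    obtain ⟨h1, h2⟩ := Finset.mem_Icc.1 hk
    obtain ⟨l, rfl⟩ := Nat.exists_eq_add_of_le h1
    rw [prod l h2, show j + 3 + l = j + 2 + l + 1 by omega]
    simp
  rw [Finset.sum_congr rfl hterm]
  clear hterm prod step hf
  induction n, hn using Nat.le_induction with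
  | base => simp
  | succ n hn ih =>
    rw [Finset.sum_Icc_succ_top (by omega), ih]
    ring

lemma exitProb_harmonic {S : Set ℕ} {x : ℕ} (hx : x ∈ S) (b : ℤ) :
    W.exitProb x S b = W.p x * W.exitProb (x + 1) S b + W.q₁ x * W.exitProb (x - 1) S b
      + W.q₂ x * W.exitProb (x - 2) S b := by
  simp only [exitProb_eq]
  rw [W.value_of_mem hx, zero_add, toReal_op]
  exact fun y => (W.value_delta_le_one _ _).trans_lt ENNReal.one_lt_top

lemma exitProb_of_notMem {S : Set ℕ} {x : ℕ} (hx : x ∉ S) (b : ℤ) :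
    W.exitProb x S b = if (x : ℤ) = b then 1 else 0 := by
  rw [exitProb_eq, W.value_of_notMem hx, delta]
  split_ifs <;> simp

lemma exitSum_nonneg (i n : ℕ) (a b : Fin 2) : 0 ≤ W.exitSum i n a b := by
  rw [exitSum, Matrix.sum_apply]
  exact Finset.sum_nonneg fun k hk =>
    descProd_nonneg (Finset.mem_Icc.1 hk).1 W.Mtilde_nonneg a b

/-- The exit probability is harmonic inside, vanishes at `n + 1`, and is `0` or `1` at `i - 1` and
`i - 2`. The telescoped identity is then a linear equation for its value at `i`, with coefficient `1
+ ⟨e₁, S e₁⟩ > 0`. -/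
lemma exitProb_Icc {i n : ℕ} (hi : 2 ≤ i) (hn : i ≤ n) :
    W.exitProb i (Set.Icc i n) ((i : ℤ) - 1) = W.exitFormula i n ![1, -1] ∧
      W.exitProb i (Set.Icc i n) ((i : ℤ) - 2) = W.exitFormula i n ![0, 1] := by
  obtain ⟨j, rfl⟩ := Nat.exists_eq_add_of_le' hi
  have h00 := W.exitSum_nonneg (j + 2) n 0 0
  have hn1 : n + 1 ∉ Set.Icc (j + 2) n := by simp
  have hj1 : j + 1 ∉ Set.Icc (j + 2) n := by simp
  have hj : j ∉ Set.Icc (j + 2) n := by simp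
  have key := fun b : ℤ => W.exitSum_mulVec_of_harmonic
    (f := fun x => W.exitProb x (Set.Icc (j + 2) n) b) hn fun x hx => W.exitProb_harmonic hx b
  simp only [W.exitProb_of_notMem hn1, W.exitProb_of_notMem hj1, W.exitProb_of_notMem hj] at key
  constructor
  · have h := key (((j + 2 : ℕ) : ℤ) - 1)
    rw [if_pos (by push_cast; ring), if_neg (by push_cast; omega),
      if_neg (by push_cast; omega)] at h
    simp [exitFormula, Matrix.mulVec, dotProduct, Fin.sum_univ_two] at h ⊢
    rw [eq_div_iff (by positivity)]
    linear_combination -h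
  · have h := key (((j + 2 : ℕ) : ℤ) - 2)
    rw [if_neg (by push_cast; omega), if_pos (by push_cast; ring),
      if_neg (by push_cast; omega)] at h
    simp [exitFormula, Matrix.mulVec, dotProduct, Fin.sum_univ_two] at h ⊢
    rw [eq_div_iff (by positivity)]
    linear_combination -h

lemma tendsto_exitProb_Icc {i : ℕ} {b : ℤ} (hb : b < i) :
    Tendsto (fun n => W.exitProb i (Set.Icc i n) b) atTop (𝓝 (W.exitProb i (Set.Ici i) b)) := by
  -- As `b < i`, being at `b` already means being outside `S`. Without that redundant condition the
  -- events visibly increase with `n`.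
  have hset : ∀ S : Set ℕ, (S = Set.Ici i ∨ ∃ n, S = Set.Icc i n) →
      {ω : ℕ → ℕ | ∃ m : ℕ, (∀ k < m, ω k ∈ S) ∧ ω m ∉ S ∧ (ω m : ℤ) = b}
        = {ω | ∃ m : ℕ, (∀ k < m, ω k ∈ S) ∧ (ω m : ℤ) = b} := by
    intro S hS
    ext ω
    refine exists_congr fun m => ⟨fun h => ⟨h.1, h.2.2⟩, fun h => ⟨h.1, fun h' => ?_, h.2⟩⟩
    have h2 := h.2
    rcases hS with rfl | ⟨n, rfl⟩
    · have : i ≤ ω m := h'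
      omega
    · have : i ≤ ω m := h'.1
      omega
  have hU : {ω : ℕ → ℕ | ∃ m : ℕ, (∀ k < m, ω k ∈ Set.Ici i) ∧ (ω m : ℤ) = b}
      = ⋃ n, {ω | ∃ m : ℕ, (∀ k < m, ω k ∈ Set.Icc i n) ∧ (ω m : ℤ) = b} := by
    ext ω
    simp only [Set.mem_iUnion]
    constructor
    · rintro ⟨m, h1, h2⟩
      -- The sum is a convenient upper bound for the finitely many positions before the exit.
      refine ⟨∑ k ∈ Finset.range m, ω k, m, fun k hk => ⟨h1 k hk, ?_⟩, h2⟩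
      exact Finset.single_le_sum (f := ω) (fun _ _ => Nat.zero_le _) (Finset.mem_range.2 hk)
    · rintro ⟨n, m, h1, h2⟩
      exact ⟨m, fun k hk => (h1 k hk).1, h2⟩
  unfold exitProb Measure.real
  rw [hset _ (Or.inl rfl), hU]
  simp_rw [hset _ (Or.inr ⟨_, rfl⟩)]
  refine (ENNReal.tendsto_toReal (measure_ne_top _ _)).comp (tendsto_measure_iUnion_atTop ?_)
  rintro n n' hn ω ⟨m, h1, h2⟩
  exact ⟨m, fun k hk => ⟨(h1 k hk).1, (h1 k hk).2.trans hn⟩, h2⟩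

lemma tendsto_exitFormula {i : ℕ} (hi : 2 ≤ i) :
    Tendsto (fun n => W.exitFormula i n ![1, -1]) atTop
        (𝓝 (W.exitProb i (Set.Ici i) ((i : ℤ) - 1))) ∧
      Tendsto (fun n => W.exitFormula i n ![0, 1]) atTop
        (𝓝 (W.exitProb i (Set.Ici i) ((i : ℤ) - 2))) := by
  constructor
  · refine (W.tendsto_exitProb_Icc (b := (i : ℤ) - 1) (by omega)).congr' ?_
    filter_upwards [eventually_ge_atTop i] with n hn using (W.exitProb_Icc hi hn).1
  · refine (W.tendsto_exitProb_Icc (b := (i : ℤ) - 2) (by omega)).congr' ?_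
    filter_upwards [eventually_ge_atTop i] with n hn using (W.exitProb_Icc hi hn).2

/-! ### Mean upward passage times through the lower branching matrices. -/

lemma toReal_meanT_zero : (W.meanT 0 1).toReal = 1 := by
  have := W.meanT_succ_step 0
  rw [q₁_zero, q₂_zero] at this
  simp [this]

lemma toReal_meanT_one :
    W.p 1 * (W.meanT 1 2).toReal = 1 + (W.q₁ 1 + W.q₂ 1) := by
  have h := W.meanT_succ_step 1
  have h0 := W.exitTime_Iio_add_two 0
  simp only [zero_add] at h0
  have f0 := (W.meanT_succ_lt_top 0).ne
  have f1 := (W.meanT_succ_lt_top 1).ne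
  simp only [zero_add, one_add_one_eq_two, le_refl, Nat.sub_eq_zero_of_le, Nat.reduceSub] at f0 f1 h
  rw [h0, ← add_mul, ← ENNReal.ofReal_add (W.q₁_nonneg 1) (W.q₂_nonneg 1)] at h
  have h' := congrArg ENNReal.toReal h
  rw [ENNReal.toReal_add ENNReal.one_ne_top
      (ENNReal.mul_ne_top ENNReal.ofReal_ne_top (ENNReal.add_ne_top.2 ⟨f0, f1⟩)),
    ENNReal.toReal_mul, ENNReal.toReal_ofReal (add_nonneg (W.q₁_nonneg 1) (W.q₂_nonneg 1)),
    ENNReal.toReal_add f0 f1, ENNReal.toReal_one, toReal_meanT_zero] at h'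
  linear_combination h' + (W.meanT 1 2).toReal * W.sum_eq_one 1

lemma toReal_meanT_add_two (i : ℕ) :
    W.p (i + 2) * (W.meanT (i + 2) (i + 3)).toReal
      = 1 + W.q₁ (i + 2) * (W.meanT (i + 1) (i + 2)).toReal
        + W.q₂ (i + 2) * ((W.meanT i (i + 1)).toReal + (W.meanT (i + 1) (i + 2)).toReal) := by
  have f0 := (W.meanT_succ_lt_top i).ne
  have f1 := (W.meanT_succ_lt_top (i + 1)).ne
  have f2 := (W.meanT_succ_lt_top (i + 2)).ne
  have h := W.meanT_succ_step (i + 2)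
  rw [show i + 2 - 1 = i + 1 from rfl, Nat.add_sub_cancel, W.exitTime_Iio_add_two (i + 1),
    W.exitTime_Iio_add_three i] at h
  have h' := congrArg ENNReal.toReal h
  have g1 := ENNReal.add_ne_top.2 ⟨f1, f2⟩
  have g2 := ENNReal.add_ne_top.2 ⟨ENNReal.add_ne_top.2 ⟨f0, f1⟩, f2⟩
  rw [ENNReal.toReal_add ENNReal.one_ne_top (ENNReal.add_ne_top.2
      ⟨ENNReal.mul_ne_top ENNReal.ofReal_ne_top g1, ENNReal.mul_ne_top ENNReal.ofReal_ne_top g2⟩),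
    ENNReal.toReal_add (ENNReal.mul_ne_top ENNReal.ofReal_ne_top g1)
      (ENNReal.mul_ne_top ENNReal.ofReal_ne_top g2),
    ENNReal.toReal_mul, ENNReal.toReal_mul, ENNReal.toReal_ofReal (W.q₁_nonneg _),
    ENNReal.toReal_ofReal (W.q₂_nonneg _), ENNReal.toReal_add f1 f2,
    ENNReal.toReal_add (ENNReal.add_ne_top.2 ⟨f0, f1⟩) f2, ENNReal.toReal_add f0 f1,
    ENNReal.toReal_one] at h'
  linear_combination h' + (W.meanT (i + 2) (i + 3)).toReal * W.sum_eq_one (i + 2)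

/-- A Horner scheme: the summand `k = 1` is `M_{i+1}` applied to `(2, 1)'`, and every other summand
has `M_{i+1}` as left factor. -/
lemma sum_descProd_M_succ (i : ℕ) :
    ∑ k ∈ Finset.Icc 1 (i + 1), descProd W.M (i + 1) (i + 1 - k + 1) *ᵥ ![2, 1]
      = W.M (i + 1) *ᵥ (![2, 1] + ∑ k ∈ Finset.Icc 1 i, descProd W.M i (i - k + 1) *ᵥ ![2, 1]) := by
  rw [Matrix.mulVec_add, Matrix.mulVec_sum, ← Finset.add_sum_Ioc_eq_sum_Icc (by omega : 1 ≤ i + 1),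
    Nat.add_sub_cancel, descProd_self]
  congr 1
  refine (Finset.sum_bij (fun k _ => k + 1) ?_ ?_ ?_ ?_).symm
  · intro k hk
    simp only [Finset.mem_Icc, Finset.mem_Ioc] at *
    omega
  · intro a _ b _ h
    omega
  · intro b hb
    simp only [Finset.mem_Icc, Finset.mem_Ioc] at *
    exact ⟨b - 1, by omega, by omega⟩
  · intro k hk
    rw [show i + 1 - (k + 1) + 1 = i - k + 1 by omega, descProd_succ _ (by omega),
      Matrix.mulVec_mulVec]

/-- Only the first coordinate is wanted. The second, the mean passage time from `i` to `i + 2`, is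
carried along because a jump by two has to be made up over two levels; with it the induction closes.
-/
lemma sum_descProd_M (i : ℕ) :
    ∑ k ∈ Finset.Icc 1 (i + 1), descProd W.M (i + 1) (i + 1 - k + 1) *ᵥ ![2, 1]
      = ![(W.meanT (i + 1) (i + 2)).toReal - 1,
          (W.meanT i (i + 1)).toReal + (W.meanT (i + 1) (i + 2)).toReal] := by
  induction i with
  | zero =>
    rw [sum_descProd_M_succ]
    have h0 := W.toReal_meanT_zero
    have h1 := W.toReal_meanT_one
    have hs := W.sum_eq_one 1
    have hp := (W.p_pos' 1).ne'
    ext a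
    fin_cases a
    · simp [M, Matrix.mulVec, dotProduct, Fin.sum_univ_two]
      field_simp
      linear_combination -h1 + hs
    · simp [M, Matrix.mulVec, dotProduct, Fin.sum_univ_two, h0]
      field_simp
      linear_combination -h1 - hs
  | succ i ih =>
    rw [sum_descProd_M_succ, ih]
    have h1 := W.toReal_meanT_add_two i
    have hs := W.sum_eq_one (i + 2)
    have hp := (W.p_pos' (i + 2)).ne'
    ext a
    fin_cases a
    · simp [M, Matrix.mulVec, dotProduct, Fin.sum_univ_two, add_assoc, one_add_one_eq_two]
      field_simp
      ring_nf at h1 hs ⊢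
      linear_combination -h1 + hs
    · simp [M, Matrix.mulVec, dotProduct, Fin.sum_univ_two, add_assoc, one_add_one_eq_two]
      field_simp
      ring_nf at h1 hs ⊢
      linear_combination -h1 + hs

lemma toReal_meanT_succ (i : ℕ) : (W.meanT i (i + 1)).toReal =
    1 + ∑ k ∈ Finset.Icc 1 i, ![1, 0] ⬝ᵥ descProd W.M i (i - k + 1) *ᵥ ![2, 1] := by
  cases i with
  | zero => simp [toReal_meanT_zero]
  | succ i =>
    rw [← dotProduct_sum, sum_descProd_M]
    simp

/-! ### Minimality of the mean descent times. -/

/-- The function `F` with `F = 0` below `i` and `F x = ℓ x + u x * F (x - 1) + d x * F (x - 2)`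
from `i` on, where `u x`, `d x` are the probabilities of leaving `{x, x+1, …}` at `x - 1`, `x - 2`. -/
def descentSum (i : ℕ) (ℓ : ℕ → ℝ≥0∞) : ℕ → ℝ≥0∞
  | 0 => 0
  | x + 1 => if x + 1 < i then 0 else
      ℓ (x + 1) + (W.downOne (x + 1) * descentSum i ℓ x + W.downTwo (x + 1) * descentSum i ℓ (x - 1))

lemma descentSum_of_lt {i x : ℕ} {ℓ : ℕ → ℝ≥0∞} (h : x < i) : W.descentSum i ℓ x = 0 := by
  cases x with
  | zero => rw [descentSum]
  | succ x => rw [descentSum, if_pos h]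

lemma descentSum_of_le {i x : ℕ} {ℓ : ℕ → ℝ≥0∞} (hi : 1 ≤ i) (h : i ≤ x) :
    W.descentSum i ℓ x = ℓ x + (W.downOne x * W.descentSum i ℓ (x - 1)
      + W.downTwo x * W.descentSum i ℓ (x - 2)) := by
  obtain ⟨x, rfl⟩ : ∃ y, x = y + 1 := ⟨x - 1, by omega⟩
  rw [descentSum, if_neg (by omega)]
  rfl

/-- A comparison principle: the mean exit times from `{i, i+1, …}` form the least solution of
their recursion. -/
lemma exitTime_Ici_le {ℓ : ℕ → ℝ≥0∞}
    (hℓ : ∀ k, 1 ≤ k →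
      1 + ENNReal.ofReal (W.p k) * (ℓ (k + 1) + W.downOne (k + 1) * ℓ k) ≤ ℓ k)
    {i : ℕ} (hi : 1 ≤ i) : W.exitTime (Set.Ici i) i ≤ ℓ i := by
  -- `descentSum i ℓ` is a supersolution of the exit-time equation, and at `i` it equals `ℓ i`
  -- because it vanishes below `i`.
  have key : W.exitTime (Set.Ici i) i ≤ W.descentSum i ℓ i := by
    refine W.value_le (fun x hx => ?_) (fun _ _ => zero_le) i
    have hx' : i ≤ x := hx
    have e1 := W.descentSum_of_le (ℓ := ℓ) hi (show i ≤ x + 1 by omega)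
    rw [Nat.add_sub_cancel, show x + 1 - 2 = x - 1 by omega] at e1
    have e0 := W.descentSum_of_le (ℓ := ℓ) hi hx'
    have hu : W.downOne x * W.descentSum i ℓ (x - 1) = (ENNReal.ofReal (W.p x) *
        (W.downOne (x + 1) * W.downOne x + W.downTwo (x + 1)) + ENNReal.ofReal (W.q₁ x))
          * W.descentSum i ℓ (x - 1) := by
      -- The recursion for `downOne` needs `x ≥ 2`. For `x = 1` also `i = 1`, and the factor
      -- `descentSum` vanishes at `0`.
      rcases Nat.lt_or_ge x 2 with h | h
      · rw [W.descentSum_of_lt (by omega), mul_zero, mul_zero]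
      · rw [← W.downOne_eq h]
    have hd : W.downTwo x * W.descentSum i ℓ (x - 2) = (ENNReal.ofReal (W.p x) *
        (W.downOne (x + 1) * W.downTwo x) + ENNReal.ofReal (W.q₂ x))
          * W.descentSum i ℓ (x - 2) := by
      rcases Nat.lt_or_ge x 2 with h | h
      · rw [W.descentSum_of_lt (by omega), mul_zero, mul_zero]
      · rw [← W.downTwo_eq h]
    calc 1 + W.op (W.descentSum i ℓ) x
        = (1 + ENNReal.ofReal (W.p x) * (ℓ (x + 1) + W.downOne (x + 1) * ℓ x))
          + ((ENNReal.ofReal (W.p x) * (W.downOne (x + 1) * W.downOne x + W.downTwo (x + 1))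
              + ENNReal.ofReal (W.q₁ x)) * W.descentSum i ℓ (x - 1)
            + (ENNReal.ofReal (W.p x) * (W.downOne (x + 1) * W.downTwo x)
              + ENNReal.ofReal (W.q₂ x)) * W.descentSum i ℓ (x - 2)) := by
          rw [op, e1, e0]; ring
      _ ≤ W.descentSum i ℓ x := by
          rw [← hu, ← hd, e0]
          gcongr
          exact hℓ x (by omega)
  rw [W.descentSum_of_le hi le_rfl, W.descentSum_of_lt (by omega), W.descentSum_of_lt (by omega)]
    at key
  simpa using key

/-! ### Mean descent times through the upper branching matrices. -/

lemma gamma_eq (k : ℕ) : W.gamma k = W.p k * (W.downTwo (k + 1)).toReal := by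
  rw [gamma, exitProb_Ici_succ_sub_one]

lemma gamma_nonneg (k : ℕ) : 0 ≤ W.gamma k := by
  rw [gamma_eq]; exact mul_nonneg (W.p_nonneg k) ENNReal.toReal_nonneg

lemma toReal_downOne_eq {k : ℕ} (hk : 2 ≤ k) :
    (W.downOne k).toReal * (1 - W.p k * (W.downOne (k + 1)).toReal) = W.q₁ k + W.gamma k := by
  have f0 := (W.downOne_lt_top k).ne
  have f1 := (W.downOne_lt_top (k + 1)).ne
  have f2 := (W.downTwo_lt_top (k + 1)).ne
  have h' := congrArg ENNReal.toReal (W.downOne_eq hk)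
  have g := ENNReal.add_ne_top.2 ⟨ENNReal.mul_ne_top f1 f0, f2⟩
  rw [ENNReal.toReal_add (ENNReal.mul_ne_top ENNReal.ofReal_ne_top g) ENNReal.ofReal_ne_top,
    ENNReal.toReal_mul, ENNReal.toReal_add (ENNReal.mul_ne_top f1 f0) f2, ENNReal.toReal_mul,
    ENNReal.toReal_ofReal (W.p_nonneg k), ENNReal.toReal_ofReal (W.q₁_nonneg k)] at h'
  rw [gamma_eq]
  linear_combination h'

lemma toReal_downTwo_eq {k : ℕ} (hk : 2 ≤ k) :
    (W.downTwo k).toReal * (1 - W.p k * (W.downOne (k + 1)).toReal) = W.q₂ k := by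
  have f0 := (W.downTwo_lt_top k).ne
  have f1 := (W.downOne_lt_top (k + 1)).ne
  have h' := congrArg ENNReal.toReal (W.downTwo_eq hk)
  rw [ENNReal.toReal_add (ENNReal.mul_ne_top ENNReal.ofReal_ne_top (ENNReal.mul_ne_top f1 f0))
      ENNReal.ofReal_ne_top, ENNReal.toReal_mul, ENNReal.toReal_mul,
    ENNReal.toReal_ofReal (W.p_nonneg k), ENNReal.toReal_ofReal (W.q₂_nonneg k)] at h'
  linear_combination h'

lemma toReal_downOne_le_one (k : ℕ) : (W.downOne k).toReal ≤ 1 := by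
  rw [← ENNReal.toReal_one]
  exact ENNReal.toReal_mono ENNReal.one_ne_top (W.value_delta_le_one _ _)

lemma p_mul_downOne_lt_one {k : ℕ} (hk : 1 ≤ k) : W.p k * (W.downOne (k + 1)).toReal < 1 := by
  have h1 := W.p_lt_one k hk
  have h2 := W.p_nonneg k
  have h3 := W.toReal_downOne_le_one (k + 1)
  nlinarith

/-- By `toReal_downOne_eq` the factor `q₁ + γ` in `downOne (k + 1)` cancels the denominator of `α`.
If it is zero, then `q₁ (k + 1) = 0` and both sides vanish. -/
lemma alpha_eq {k : ℕ} (hk : 1 ≤ k) : W.alpha k * (1 - W.p (k + 1) * (W.downOne (k + 2)).toReal)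
    = W.p k * W.q₁ (k + 1) := by
  have h := W.toReal_downOne_eq (show 2 ≤ k + 1 by omega)
  have h1 := W.p_mul_downOne_lt_one (show 1 ≤ k + 1 by omega)
  rw [alpha, exitProb_Ici_succ_self]
  by_cases h0 : W.q₁ (k + 1) + W.gamma (k + 1) = 0
  · have : W.q₁ (k + 1) = 0 := by
      linarith [W.q₁_nonneg (k + 1), W.gamma_nonneg (k + 1)]
    rw [this]; simp
  · field_simp
    linear_combination W.p k * W.q₁ (k + 1) * h

lemma beta_eq {k : ℕ} (hk : 1 ≤ k) : W.beta k * (1 - W.p (k + 1) * (W.downOne (k + 2)).toReal)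
    = W.p k * W.gamma (k + 1) := by
  have h := W.toReal_downOne_eq (show 2 ≤ k + 1 by omega)
  have h1 := W.p_mul_downOne_lt_one (show 1 ≤ k + 1 by omega)
  rw [beta, exitProb_Ici_succ_self]
  by_cases h0 : W.q₁ (k + 1) + W.gamma (k + 1) = 0
  · have : W.gamma (k + 1) = 0 := by
      linarith [W.q₁_nonneg (k + 1), W.gamma_nonneg (k + 1)]
    rw [this]; simp
  · field_simp
    linear_combination W.p k * W.gamma (k + 1) * h

lemma alpha_add_beta {k : ℕ} (hk : 1 ≤ k) :
    W.alpha k + W.beta k = W.p k * (W.downOne (k + 1)).toReal := by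
  have h := W.toReal_downOne_eq (show 2 ≤ k + 1 by omega)
  have h1 := W.p_mul_downOne_lt_one (show 1 ≤ k + 1 by omega)
  have h2 := W.alpha_eq hk
  have h3 := W.beta_eq hk
  refine mul_right_cancel₀ (sub_pos.2 h1).ne' ?_
  linear_combination h2 + h3 - W.p k * h

lemma alpha_nonneg (k : ℕ) : 0 ≤ W.alpha k := by
  rw [alpha, exitProb_Ici_succ_self]
  exact mul_nonneg (mul_nonneg (W.p_nonneg k) ENNReal.toReal_nonneg)
    (div_nonneg (W.q₁_nonneg _) (add_nonneg (W.q₁_nonneg _) (W.gamma_nonneg _)))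

lemma beta_nonneg (k : ℕ) : 0 ≤ W.beta k := by
  rw [beta, exitProb_Ici_succ_self]
  exact mul_nonneg (mul_nonneg (W.p_nonneg k) ENNReal.toReal_nonneg)
    (div_nonneg (W.gamma_nonneg _) (add_nonneg (W.q₁_nonneg _) (W.gamma_nonneg _)))

lemma one_sub_alpha_sub_beta_pos {k : ℕ} (hk : 1 ≤ k) : 0 < 1 - W.alpha k - W.beta k := by
  linarith [W.alpha_add_beta hk, W.p_mul_downOne_lt_one hk]

lemma N_nonneg {k : ℕ} (hk : 1 ≤ k) (a b : Fin 3) : 0 ≤ W.N k a b := by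
  have h1 := div_nonneg (W.alpha_nonneg k) (W.one_sub_alpha_sub_beta_pos hk).le
  have h2 := div_nonneg (W.beta_nonneg k) (W.one_sub_alpha_sub_beta_pos hk).le
  fin_cases a <;> fin_cases b <;> simp [N, h1, h2]

/-- The partial sums `∑_{m < L} N_i ⋯ N_{i+m} (2, 2, 1)'`. -/
def upperSum (L i : ℕ) : Fin 3 → ℝ :=
  ∑ m ∈ Finset.range L, ascProd W.N i (i + m) *ᵥ ![2, 2, 1]

lemma upperSum_succ (L i : ℕ) :
    W.upperSum (L + 1) i = W.N i *ᵥ (![2, 2, 1] + W.upperSum L (i + 1)) := by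
  rw [upperSum, Finset.sum_range_succ', add_zero, ascProd_self, add_comm, Matrix.mulVec_add,
    upperSum, Matrix.mulVec_sum]
  congr 1
  refine Finset.sum_congr rfl fun m _ => ?_
  rw [ascProd_succ _ (by omega), Matrix.mulVec_mulVec, show i + (m + 1) = i + 1 + m by omega]

lemma upperSum_nonneg {i : ℕ} (hi : 1 ≤ i) (L : ℕ) (a : Fin 3) : 0 ≤ W.upperSum L i a := by
  rw [upperSum, Finset.sum_apply]
  refine Finset.sum_nonneg fun m _ => ?_
  rw [Matrix.mulVec, dotProduct]
  refine Finset.sum_nonneg fun b _ => mul_nonneg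
    (ascProd_nonneg (i := i) m (fun j hj => W.N_nonneg (hi.trans hj)) a b) ?_
  fin_cases b <;> simp

lemma upperSum_two (L i : ℕ) : W.upperSum L i 2 = W.upperSum L i 0 := by
  cases L with
  | zero => simp [upperSum]
  | succ L =>
    rw [upperSum_succ]
    simp [N, Matrix.mulVec, dotProduct, Fin.sum_univ_three]

lemma upperSum_succ_one (L i : ℕ) :
    W.upperSum (L + 1) i 1 = W.upperSum (L + 1) i 0 + 1 + W.upperSum L (i + 1) 2 := by
  rw [upperSum_succ]
  simp [N, Matrix.mulVec, dotProduct, Fin.sum_univ_three]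
  ring

/-- The partial sums of the series for the mean exit time from `{i, i+1, …}`. -/
def upperMean (L i : ℕ) : ℝ := 1 + W.immigration i ⬝ᵥ W.upperSum L i

/-- The descent from `k + 1` is almost surely finite, so its two exit probabilities sum to `1`.
Hence the weights in `immigration` sum to `1`. -/
lemma q_add_gamma (hW : W.exitTime (Set.Ici 1) 1 < ∞) {k : ℕ} (hk : 1 ≤ k) :
    W.q₁ k + W.gamma k + W.q₂ k = 1 - W.alpha k - W.beta k := by
  have h1 := W.downOne_add_downTwo (k := k + 1) (by omega) (W.exitTime_Ici_lt_top hW (by omega))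
  have h2 := congrArg ENNReal.toReal h1
  rw [ENNReal.toReal_add (W.downOne_lt_top _).ne (W.downTwo_lt_top _).ne, ENNReal.toReal_one] at h2
  have h3 := W.alpha_add_beta hk
  rw [gamma_eq]
  linear_combination W.sum_eq_one k + h3 + W.p k * h2

/-- The recursion of `toReal_exitTime_Ici`, with one term fewer at the next level; this is what
makes the series comparable with the mean exit times. -/
lemma upperMean_succ (hW : W.exitTime (Set.Ici 1) 1 < ∞) {i : ℕ} (hi : 1 ≤ i) (L : ℕ) :
    (1 - W.alpha i - W.beta i) * W.upperMean (L + 1) i = 1 + W.p i * W.upperMean L (i + 1) := by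
  have hA := W.one_sub_alpha_sub_beta_pos hi
  have hA' := W.one_sub_alpha_sub_beta_pos (show 1 ≤ i + 1 by omega)
  have hg := W.q_add_gamma hW hi
  have hg' := W.q_add_gamma hW (show 1 ≤ i + 1 by omega)
  have hab' := W.alpha_add_beta (show 1 ≤ i + 1 by omega)
  have ha := W.alpha_eq hi
  have hb := W.beta_eq hi
  have hd := W.toReal_downTwo_eq (show 2 ≤ i + 1 by omega)
  have hge := W.gamma_eq i
  have hz := W.upperSum_two L (i + 1)
  have hD : 1 - W.p (i + 1) * (W.downOne (i + 2)).toReal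
    = 1 - W.alpha (i + 1) - W.beta (i + 1) := by linear_combination hab'
  rw [show i + 1 + 1 = i + 2 from rfl] at hd
  rw [hD] at ha hb hd
  set x := W.upperSum L (i + 1) 0 with hx
  set y := W.upperSum L (i + 1) 1 with hy
  have e1 : (1 - W.alpha i - W.beta i) * W.upperMean (L + 1) i
      = (1 - W.alpha i - W.beta i) + (W.alpha i * (2 + x) + W.beta i * (2 + y))
        + W.gamma i * (1 + x) := by
    rw [upperMean, upperSum_succ]
    simp [immigration, N, dotProduct, Fin.sum_univ_three, Matrix.mulVec, hz, ← hx, ← hy]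
    generalize W.alpha i = a at *
    generalize W.beta i = b at *
    have hA0 := hA.ne'
    field_simp
    linear_combination (a * (2 + x) + b * (2 + y)) * hg
  have e2 : (1 - W.alpha (i + 1) - W.beta (i + 1)) * W.upperMean L (i + 1)
      = (1 - W.alpha (i + 1) - W.beta (i + 1))
        + ((W.q₁ (i + 1) + W.q₂ (i + 1)) * x + W.gamma (i + 1) * y) := by
    rw [upperMean]
    simp [immigration, dotProduct, Fin.sum_univ_three, hz, ← hx, ← hy]
    have hA0 := hA'.ne'
    field_simp
    ring
  refine mul_right_cancel₀ hA'.ne' ?_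
  rw [e1]
  linear_combination (1 + x) * ha + (1 + y) * hb + (1 + x) * ((1 - W.alpha (i + 1)
    - W.beta (i + 1)) * hge + W.p i * hd) - W.p i * e2 + W.p i * hg'

lemma toReal_exitTime_Ici (hW : W.exitTime (Set.Ici 1) 1 < ∞) {i : ℕ} (hi : 1 ≤ i) :
    (1 - W.alpha i - W.beta i) * (W.exitTime (Set.Ici i) i).toReal
      = 1 + W.p i * (W.exitTime (Set.Ici (i + 1)) (i + 1)).toReal := by
  have f0 := (W.exitTime_Ici_lt_top hW hi).ne
  have f1 := (W.exitTime_Ici_lt_top hW (show 1 ≤ i + 1 by omega)).ne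
  have f2 := ENNReal.mul_ne_top (W.downOne_lt_top (i + 1)).ne f0
  have h := congrArg ENNReal.toReal (W.exitTime_Ici_eq hi)
  rw [ENNReal.toReal_add ENNReal.one_ne_top
      (ENNReal.mul_ne_top ENNReal.ofReal_ne_top (ENNReal.add_ne_top.2 ⟨f1, f2⟩)),
    ENNReal.toReal_mul, ENNReal.toReal_ofReal (W.p_nonneg i), ENNReal.toReal_add f1 f2,
    ENNReal.toReal_mul, ENNReal.toReal_one] at h
  linear_combination h - (W.exitTime (Set.Ici i) i).toReal * W.alpha_add_beta hi

lemma one_le_toReal_exitTime_Ici (hW : W.exitTime (Set.Ici 1) 1 < ∞) {i : ℕ} (hi : 1 ≤ i) :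
    1 ≤ (W.exitTime (Set.Ici i) i).toReal := by
  rw [← ENNReal.toReal_one]
  refine ENNReal.toReal_mono (W.exitTime_Ici_lt_top hW hi).ne ?_
  rw [W.exitTime_of_mem Set.self_mem_Ici]
  exact le_self_add

lemma upperMean_le (hW : W.exitTime (Set.Ici 1) 1 < ∞) (L : ℕ) {i : ℕ} (hi : 1 ≤ i) :
    W.upperMean L i ≤ (W.exitTime (Set.Ici i) i).toReal := by
  induction L generalizing i with
  | zero => simpa [upperMean, upperSum] using W.one_le_toReal_exitTime_Ici hW hi
  | succ L ih =>
    refine le_of_mul_le_mul_left ?_ (W.one_sub_alpha_sub_beta_pos hi)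
    rw [W.upperMean_succ hW hi, W.toReal_exitTime_Ici hW hi]
    have := mul_le_mul_of_nonneg_left (ih (show 1 ≤ i + 1 by omega)) (W.p_nonneg i)
    linarith

/-- `upperMean` is `1` plus a weighted average of the coordinates of `upperSum`, whose smallest
coordinate is the one with index `0`. -/
lemma upperSum_zero_le (hW : W.exitTime (Set.Ici 1) 1 < ∞) (L : ℕ) {i : ℕ} (hi : 1 ≤ i) :
    W.upperSum L i 0 ≤ (W.exitTime (Set.Ici i) i).toReal := by
  refine le_trans ?_ (W.upperMean_le hW L hi)
  have hA := W.one_sub_alpha_sub_beta_pos hi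
  have h01 : W.upperSum L i 0 ≤ W.upperSum L i 1 := by
    cases L with
    | zero => simp [upperSum]
    | succ L =>
      rw [upperSum_succ_one]
      linarith [W.upperSum_nonneg (show 1 ≤ i + 1 by omega) L 2]
  refine le_of_mul_le_mul_left ?_ hA
  have e : (1 - W.alpha i - W.beta i) * W.upperMean L i = (1 - W.alpha i - W.beta i)
      + (W.q₁ i * W.upperSum L i 0 + W.gamma i * W.upperSum L i 1
        + W.q₂ i * W.upperSum L i 2) := by
    rw [upperMean]
    simp only [immigration, dotProduct, Fin.sum_univ_three]
    simp
    have := hA.ne'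
    field_simp
  rw [e, upperSum_two, ← W.q_add_gamma hW hi]
  have := mul_le_mul_of_nonneg_left h01 (W.gamma_nonneg i)
  have h3 := W.q_add_gamma hW hi
  linarith

lemma upperSum_le (hW : W.exitTime (Set.Ici 1) 1 < ∞) (L : ℕ) {i : ℕ} (hi : 1 ≤ i) (a : Fin 3) :
    W.upperSum L i a ≤ (W.exitTime (Set.Ici i) i).toReal + 1
      + (W.exitTime (Set.Ici (i + 1)) (i + 1)).toReal := by
  have h0 := W.upperSum_zero_le hW L hi
  have h1 : (0 : ℝ) ≤ (W.exitTime (Set.Ici i) i).toReal := ENNReal.toReal_nonneg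
  have h2 : (0 : ℝ) ≤ (W.exitTime (Set.Ici (i + 1)) (i + 1)).toReal := ENNReal.toReal_nonneg
  fin_cases a
  · change W.upperSum L i 0 ≤ _
    linarith
  · change W.upperSum L i 1 ≤ _
    cases L with
    | zero =>
      simp only [upperSum, Finset.range_zero, Finset.sum_empty, Pi.zero_apply]
      linarith
    | succ L =>
      rw [upperSum_succ_one, upperSum_two]
      linarith [W.upperSum_zero_le hW L (show 1 ≤ i + 1 by omega)]
  · change W.upperSum L i 2 ≤ _
    rw [upperSum_two]
    linarith

/-- The entries are nonnegative and `(2, 2, 1)` has entries at least `1`, so the bounded vectors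
`upperSum` dominate the partial sums of each entry. -/
lemma summable_ascProd_N (hW : W.exitTime (Set.Ici 1) 1 < ∞) {i : ℕ} (hi : 1 ≤ i) :
    Summable fun m : ℕ => ascProd W.N i (i + m) := by
  have hnn := fun m a b => ascProd_nonneg (A := W.N) (i := i) m
    (fun j hj => W.N_nonneg (hi.trans hj)) a b
  refine Pi.summable.2 fun a => Pi.summable.2 fun b => ?_
  refine summable_of_sum_range_le (c := (W.exitTime (Set.Ici i) i).toReal + 1
      + (W.exitTime (Set.Ici (i + 1)) (i + 1)).toReal) (fun m => hnn m a b) fun L => ?_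
  refine le_trans ?_ (W.upperSum_le hW L hi a)
  rw [upperSum, Finset.sum_apply]
  refine Finset.sum_le_sum fun m _ => ?_
  have hv : ∀ c : Fin 3, (1 : ℝ) ≤ ![2, 2, 1] c := by
    intro c; fin_cases c <;> norm_num
  calc ascProd W.N i (i + m) a b ≤ ascProd W.N i (i + m) a b * ![2, 2, 1] b :=
        le_mul_of_one_le_right (hnn m a b) (hv b)
    _ ≤ ∑ c, ascProd W.N i (i + m) a c * ![2, 2, 1] c :=
        Finset.single_le_sum (f := fun c => ascProd W.N i (i + m) a c * ![2, 2, 1] c)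
          (fun c _ => mul_nonneg (hnn m a c) (zero_le_one.trans (hv c))) (Finset.mem_univ b)

lemma tendsto_upperMean (hW : W.exitTime (Set.Ici 1) 1 < ∞) {i : ℕ} (hi : 1 ≤ i) :
    Tendsto (fun L => W.upperMean L i) atTop (𝓝 (1 + ![2, 2, 1] ⬝ᵥ
      W.immigration i ᵥ* (∑' m : ℕ, ascProd W.N i (i + m)))) := by
  have h := (W.summable_ascProd_N hW hi).hasSum.tendsto_sum_nat
  have hc : Continuous fun B : Matrix (Fin 3) (Fin 3) ℝ =>
      1 + ![2, 2, 1] ⬝ᵥ W.immigration i ᵥ* B := by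
    fun_prop
  refine ((hc.tendsto _).comp h).congr fun L => ?_
  simp only [Function.comp_apply, upperMean, upperSum]
  rw [dotProduct_comm, ← Matrix.dotProduct_mulVec, Matrix.sum_mulVec]

/-- The mean exit time from `{i, i+1, …}` through the upper branching structure. -/
lemma toReal_exitTime_Ici_eq (hW : W.exitTime (Set.Ici 1) 1 < ∞) {i : ℕ} (hi : 1 ≤ i) :
    (W.exitTime (Set.Ici i) i).toReal = 1 + ![2, 2, 1] ⬝ᵥ
      W.immigration i ᵥ* (∑' m : ℕ, ascProd W.N i (i + m)) := by
  set l : ℕ → ℝ := fun i => 1 + ![2, 2, 1] ⬝ᵥ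
      W.immigration i ᵥ* (∑' m : ℕ, ascProd W.N i (i + m)) with hl
  have ht : ∀ k, 1 ≤ k → Tendsto (fun L => W.upperMean L k) atTop (𝓝 (l k)) :=
    fun k hk => W.tendsto_upperMean hW hk
  have hrec : ∀ k, 1 ≤ k → (1 - W.alpha k - W.beta k) * l k = 1 + W.p k * l (k + 1) := by
    intro k hk
    have h1 := ((tendsto_add_atTop_iff_nat 1).2 (ht k hk)).const_mul (1 - W.alpha k - W.beta k)
    simp_rw [W.upperMean_succ hW hk] at h1
    exact tendsto_nhds_unique h1 (((ht (k + 1) (by omega)).const_mul _).const_add 1)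
  have hnn : ∀ k, 1 ≤ k → 0 ≤ l k := by
    intro k hk
    refine ge_of_tendsto' (ht k hk) fun L => ?_
    refine add_nonneg zero_le_one (Finset.sum_nonneg fun a _ => mul_nonneg ?_
      (W.upperSum_nonneg hk L a))
    have hA := (W.one_sub_alpha_sub_beta_pos hk).le
    have h1 := W.q₁_nonneg k
    have h2 := W.q₂_nonneg k
    have h3 := W.gamma_nonneg k
    fin_cases a <;> simp [immigration] <;> positivity
  refine le_antisymm ?_ (le_of_tendsto' (ht i hi) fun L => W.upperMean_le hW L hi)
  -- The limit `l` solves the recursion and is nonnegative, so minimality gives the remaining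
  -- inequality.
  have hle : W.exitTime (Set.Ici i) i ≤ ENNReal.ofReal (l i) := by
    refine W.exitTime_Ici_le (ℓ := fun k => ENNReal.ofReal (l k)) (fun k hk => ?_) hi
    rw [← ENNReal.ofReal_toReal (W.downOne_lt_top (k + 1)).ne,
      ← ENNReal.ofReal_mul ENNReal.toReal_nonneg,
      ← ENNReal.ofReal_add (hnn _ (by omega)) (mul_nonneg ENNReal.toReal_nonneg (hnn k hk)),
      ← ENNReal.ofReal_mul (W.p_nonneg k), ← ENNReal.ofReal_one,
      ← ENNReal.ofReal_add zero_le_one (mul_nonneg (W.p_nonneg k) (add_nonneg (hnn _ (by omega))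
        (mul_nonneg ENNReal.toReal_nonneg (hnn k hk))))]
    refine ENNReal.ofReal_le_ofReal (le_of_eq ?_)
    linear_combination -hrec k hk - l k * W.alpha_add_beta hk
  exact ENNReal.toReal_le_of_le_ofReal (hnn i hi) hle

/-! ### Stationary distributions: Kac's formula and excursions. -/

lemma lintegral_bind_kernel (μ : Measure ℕ) (f : ℕ → ℝ≥0∞) :
    ∫⁻ y, f y ∂(μ.bind W.kernel) = ∫⁻ x, W.op f x ∂μ := by
  rw [Measure.lintegral_bind (Kernel.aemeasurable _) (measurable_of_countable _).aemeasurable]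
  simp_rw [lintegral_kernel]

/-- Kac's formula: a stationary distribution has mass `1 / E^i T_i` at `i`. -/
lemma stationary_mul_meanT {ν : Measure ℕ} (hν : W.IsStationaryDistribution ν) {i : ℕ}
    (hfin : ∀ x, W.exitTime {i}ᶜ x < ∞) : ν {i} * W.meanT i i = 1 := by
  obtain ⟨hprob, hinv⟩ := hν
  set a : ℕ → ℝ≥0∞ := fun n => ∫⁻ x, W.surv {i}ᶜ n x ∂ν with ha
  -- By invariance the survival event may start one step later. Splitting by the initial state, the
  -- part away from `i` is survival for one more step.
  have hstep : ∀ n, a n = ν {i} * W.op (W.surv {i}ᶜ n) i + a (n + 1) := by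
    intro n
    have h1 : a n = ∫⁻ x, W.op (W.surv {i}ᶜ n) x ∂ν := by
      rw [← lintegral_bind_kernel, hinv.def]
    rw [h1, ← lintegral_add_compl _ (measurableSet_singleton i), Measure.restrict_singleton,
      lintegral_smul_measure, lintegral_dirac, smul_eq_mul,
      ← lintegral_indicator (measurableSet_singleton i).compl]
    rfl
  have hzero : a 0 = ν {i}ᶜ := by
    rw [← lintegral_indicator_one (measurableSet_singleton i).compl]
    refine lintegral_congr fun x => ?_
    rfl
  have hsum : ∀ n, a 0 = ν {i} * ∑ k ∈ Finset.range n, W.op (W.surv {i}ᶜ k) i + a n := by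
    intro n
    induction n with
    | zero => simp
    | succ n ih => rw [ih, hstep n, Finset.sum_range_succ]; ring
  have hlim : Tendsto a atTop (𝓝 0) := by
    have := tendsto_lintegral_of_dominated_convergence (μ := ν) (F := fun n => W.surv {i}ᶜ n)
      (f := fun _ => 0) (fun _ => 1) (fun n => measurable_of_countable _)
      (fun n => Eventually.of_forall fun x => W.surv_le_one n x) (by simp)
      (Eventually.of_forall fun x => W.surv_tendsto_zero (hfin x))
    simpa using this
  have h1 : Tendsto (fun n => ν {i} * ∑ k ∈ Finset.range n, W.op (W.surv {i}ᶜ k) i + a n) atTop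
      (𝓝 (ν {i} * (∑' k, W.op (W.surv {i}ᶜ k) i) + 0)) :=
    (ENNReal.Tendsto.const_mul ENNReal.summable.hasSum.tendsto_sum_nat
      (Or.inr (measure_ne_top ν _))).add hlim
  simp_rw [← hsum] at h1
  have h2 := tendsto_nhds_unique h1 tendsto_const_nhds
  rw [add_zero, hzero, ← op_tsum] at h2
  have h3 : (fun y => ∑' n, W.surv {i}ᶜ n y) = W.exitTime {i}ᶜ := funext fun y => W.tsum_surv y
  rw [h3] at h2
  rw [meanT_eq, mul_add, mul_one, h2, measure_add_measure_compl (measurableSet_singleton i),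
    measure_univ]

/-- The distribution of the walk started at `0` at time `n`, on the event that it has not
returned to `0` up to this time. -/
def excursion : ℕ → Measure ℕ
  | 0 => Measure.dirac 0
  | n + 1 => ((excursion n).bind W.kernel).restrict {0}ᶜ

lemma lintegral_excursion_succ (n : ℕ) (f : ℕ → ℝ≥0∞) :
    ∫⁻ y, f y ∂W.excursion (n + 1) = ∫⁻ x, W.op (Set.indicator {0}ᶜ f) x ∂W.excursion n := by
  rw [excursion, ← lintegral_indicator (measurableSet_singleton 0).compl, lintegral_bind_kernel]

/-- The mass is the probability of avoiding `0` at the times `1, …, n + 1`, so the total mass of all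
`excursion n` is `E^0 T_0`. -/
lemma excursion_univ_succ (n : ℕ) :
    W.excursion (n + 1) Set.univ = W.op (W.surv {0}ᶜ n) 0 := by
  have key : ∀ n k, ∫⁻ x, W.op (W.surv {0}ᶜ k) x ∂W.excursion n = W.op (W.surv {0}ᶜ (k + n)) 0 := by
    intro n
    induction n with
    | zero => intro k; simp [excursion]
    | succ n ih =>
      intro k
      rw [lintegral_excursion_succ, show k + (n + 1) = k + 1 + n by omega, ← ih (k + 1)]
      rfl
  have h := key n 0
  rw [zero_add] at h
  rw [← h, ← lintegral_one, lintegral_excursion_succ]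
  rfl

lemma sum_excursion_univ : Measure.sum W.excursion Set.univ = W.meanT 0 0 := by
  rw [Measure.sum_apply _ MeasurableSet.univ, tsum_eq_zero_add' ENNReal.summable, meanT_eq]
  simp_rw [excursion_univ_succ]
  rw [← op_tsum]
  have h3 : (fun y => ∑' n, W.surv {0}ᶜ n y) = W.exitTime {0}ᶜ := funext fun y => W.tsum_surv y
  rw [h3]
  simp [excursion]

/-- The mean occupation measure of an excursion from `0` is invariant. -/
lemma invariant_sum_excursion (hfin : W.meanT 0 0 < ∞) :
    Kernel.Invariant W.kernel (Measure.sum W.excursion) := by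
  set μ := Measure.sum W.excursion with hμ
  have huniv : μ Set.univ < ∞ := by rw [sum_excursion_univ]; exact hfin
  have : IsFiniteMeasure μ := ⟨huniv⟩
  -- Away from `0` a transition merely shifts the index `n`, and `excursion 0` contributes nothing.
  have hne : ∀ s : Set ℕ, 0 ∉ s → μ.bind W.kernel s = μ s := by
    intro s hs
    have hss : s = s ∩ {0}ᶜ := by
      refine (Set.inter_eq_left.2 fun x hx => ?_).symm
      rintro rfl
      exact hs hx
    have h0 : W.excursion 0 s = 0 := by
      rw [excursion, Measure.dirac_apply' _ (MeasurableSet.of_discrete)]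
      simp [hs]
    rw [hμ, Measure.sum_apply _ MeasurableSet.of_discrete, tsum_eq_zero_add' ENNReal.summable, h0,
      zero_add, Measure.bind_apply MeasurableSet.of_discrete (Kernel.aemeasurable _),
      lintegral_sum_measure]
    refine tsum_congr fun n => ?_
    rw [excursion, Measure.restrict_apply MeasurableSet.of_discrete, ← hss,
      Measure.bind_apply MeasurableSet.of_discrete (Kernel.aemeasurable _)]
  have hb : μ.bind W.kernel Set.univ = μ Set.univ := by
    rw [Measure.bind_apply MeasurableSet.univ (Kernel.aemeasurable _)]
    simp
  -- The mass at `0` is recovered from conservation of total mass; finiteness of `μ` permits the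
  -- cancellation.
  have hzero : μ.bind W.kernel {0} = μ {0} := by
    have h1 := measure_add_measure_compl (μ := μ.bind W.kernel) (measurableSet_singleton 0)
    have h2 := measure_add_measure_compl (μ := μ) (measurableSet_singleton 0)
    rw [hb, ← h2, hne {0}ᶜ (by simp)] at h1
    exact (ENNReal.add_left_inj (measure_ne_top μ _)).1 h1
  refine Measure.ext_of_singleton fun x => ?_
  by_cases hx : x = 0
  · rw [hx]; exact hzero
  · exact hne {x} fun h => hx (Set.mem_singleton_iff.1 h).symm

lemma exists_stationary (hfin : W.meanT 0 0 < ∞) : ∃ π, W.IsStationaryDistribution π := by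
  have hpos : W.meanT 0 0 ≠ 0 := by
    rw [meanT_eq]
    simp
  refine ⟨(W.meanT 0 0)⁻¹ • Measure.sum W.excursion, ⟨?_⟩, ?_⟩
  · rw [Measure.smul_apply, sum_excursion_univ, smul_eq_mul,
      ENNReal.inv_mul_cancel hpos hfin.ne]
  · rw [Kernel.Invariant, Measure.bind_smul, (W.invariant_sum_excursion hfin).def]

end ReflectingWalk

end

theorem theorem1p2 (W : ReflectingWalk) (hτ : W.meanTau 1 1 < ∞) :
    -- positive recurrence
    W.PositiveRecurrent ∧
    -- the expectations in the formula for the stationary distribution are finite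
    (∀ i : ℕ, 1 ≤ i → W.meanTau i i < ∞) ∧
    (∀ i : ℕ, W.meanT i (i + 1) < ∞) ∧
    -- the stationary distribution: existence, uniqueness, and its value at every state
    (∃ π : Measure ℕ, W.IsStationaryDistribution π ∧
      (∀ ν : Measure ℕ, W.IsStationaryDistribution ν → ν = π) ∧
      ∀ i : ℕ, π.real {i} = 1 / (W.meanT i i).toReal ∧ π.real {i} = 1 / W.returnFormula i) ∧
    -- exit probabilities from `{i, …, n}`, and from `{i, i+1, …}` as `n → ∞`
    (∀ i : ℕ, 2 ≤ i →
      (∀ n : ℕ, i ≤ n →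
        W.exitProb i (Set.Icc i n) ((i : ℤ) - 1) = W.exitFormula i n ![1, -1] ∧
        W.exitProb i (Set.Icc i n) ((i : ℤ) - 2) = W.exitFormula i n ![0, 1]) ∧
      Tendsto (fun n => W.exitFormula i n ![1, -1]) atTop
        (𝓝 (W.exitProb i (Set.Ici i) ((i : ℤ) - 1))) ∧
      Tendsto (fun n => W.exitFormula i n ![0, 1]) atTop
        (𝓝 (W.exitProb i (Set.Ici i) ((i : ℤ) - 2)))) ∧
    -- `E^i τ_i` through the upper branching structure
    (∀ i : ℕ, 1 ≤ i →
      Summable (fun m : ℕ => ReflectingWalk.ascProd W.N i (i + m)) ∧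
      (W.meanTau i i).toReal =
        1 + ![2, 2, 1] ⬝ᵥ
          W.immigration i ᵥ* (∑' m : ℕ, ReflectingWalk.ascProd W.N i (i + m))) ∧
    -- `E^i T_{i+1}` through the lower branching structure
    (∀ i : ℕ, (W.meanT i (i + 1)).toReal =
      1 + ∑ k ∈ Finset.Icc 1 i,
        ![1, 0] ⬝ᵥ ReflectingWalk.descProd W.M i (i - k + 1) *ᵥ ![2, 1]) := by
  have hW : W.exitTime (Set.Ici 1) 1 < ∞ := by rwa [← W.meanTau_eq_exitTime le_rfl]
  have hret : ∀ i, W.meanT i i < ∞ := W.meanT_self_lt_top hW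
  have hkac : ∀ (ν : Measure ℕ), W.IsStationaryDistribution ν → ∀ i, ν {i} = (W.meanT i i)⁻¹ :=
    fun ν hν i => ENNReal.eq_inv_of_mul_eq_one_left
      (W.stationary_mul_meanT hν (W.exitTime_compl_singleton_lt_top hW i))
  refine ⟨hret, ?_, W.meanT_succ_lt_top, ?_, ?_, ?_, W.toReal_meanT_succ⟩
  · intro i hi
    rw [W.meanTau_eq_exitTime hi]
    exact W.exitTime_Ici_lt_top hW hi
  · obtain ⟨π, hπ⟩ := W.exists_stationary (hret 0)
    refine ⟨π, hπ, fun ν hν => ?_, fun i => ?_⟩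
    · exact Measure.ext_of_singleton fun i => by rw [hkac ν hν, hkac π hπ]
    · rw [← W.toReal_meanT_self hW, and_self, Measure.real, hkac π hπ, ENNReal.toReal_inv, one_div]
  · exact fun i hi => ⟨fun n hn => W.exitProb_Icc hi hn, W.tendsto_exitFormula hi⟩
  · intro i hi
    rw [W.meanTau_eq_exitTime hi]
    exact ⟨W.summable_ascProd_N hW hi, W.toReal_exitTime_Ici_eq hW hi⟩
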